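/- Let $d\in\mathbb N$ and $0<\alpha<2$. Let $p_t(x)$, $t>0$, $x\in\mathbb R^d$, be the density of the isotropic $\alpha$-stable convolution semigroup on $\mathbb R^d$, that is, the function with Fourier transform $e^{-t|\xi|^\alpha}$, $$p_t(x)=(2\pi)^{-d}\int_{\mathbb R^d}\cos(\xi\cdot x)\,e^{-t|\xi|^\alpha}\,d\xi ,$$ and put $p_t(x,y)=p_t(y-x)$. For measurable $q:\mathbb R^d\to[0,\infty]$, the Schrödinger perturbation of $p$ by $q$ is $\tilde p=\sum_{n=0}^\infty p^{(n)}$, where $p^{(0)}=p$ and $$p^{(n)}_t(x,y)=\int_0^t\int_{\mathbb R^d}p_s(x,z)\,q(z)\,p^{(n-1)}_{t-s}(z,y)\,dz\,ds,\qquad n\ge1 .$$ Below, $|0|^{-r}=\infty$ for $r>0$ and $|0|^{0}=1$. (i) If $0\le r\le d-\alpha$, $x\in\mathbb R^d$ and $t>0$, then $$\int_{\mathbb R^d}p_t(x,y)\,|y|^{-r}\,dy\le|x|^{-r}.$$ (ii) If $0<r<d-\alpha$, $x\in\mathbb R^d$, $t>0$, $\beta=(d-\alpha-r)/\alpha$ and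 $\tilde p$ is the Schrödinger perturbation of $p$ by $$q(x)=\frac{4^{\alpha/2}\,\Gamma\!\left(\frac d2-\frac{\alpha\beta}2\right)\Gamma\!\left(\frac{\alpha(\beta+1)}2\right)}{\Gamma\!\left(\frac d2-\frac{\alpha(\beta+1)}2\right)\Gamma\!\left(\frac{\alpha\beta}2\right)}\,|x|^{-\alpha},$$ then $$\int_{\mathbb R^d}\tilde p_t(x,y)\,|y|^{-r}\,dy\le|x|^{-r}.$$ -/

import Mathlib

open MeasureTheory
open scoped ENNReal

/-- The density `p_t(x)` of the isotropic `α`-stable convolution semigroup on `ℝ^d`, the function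
with Fourier transform `ξ ↦ exp (-t |ξ|^α)`:
`p_t(x) = (2π)^{-d} ∫ cos (ξ · x) exp (-t |ξ|^α) dξ`.
(The imaginary part of the Fourier inversion integral vanishes by symmetry.) It is the Gaussian
kernel `g_s(x) = (4πs)^{-d/2} exp (-|x|^2/(4s))`, whose Fourier transform is `exp (-s |ξ|^2)`,
subordinated by the `α/2`-stable subordinator, `E exp (-u S_t) = exp (-t u^{α/2})`. -/
noncomputable def stableDensity (d : ℕ) (α t : ℝ) (x : EuclideanSpace ℝ (Fin d)) : ℝ :=
  ((2 * Real.pi) ^ d)⁻¹ *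
    ∫ ξ : EuclideanSpace ℝ (Fin d), Real.cos (inner ℝ ξ x) * Real.exp (-t * ‖ξ‖ ^ α)

/-- The transition density `p_t(x, y) = p_t(y - x)`, with values in `[0, ∞]`. -/
noncomputable def stableKernel (d : ℕ) (α t : ℝ) (x y : EuclideanSpace ℝ (Fin d)) : ℝ≥0∞ :=
  ENNReal.ofReal (stableDensity d α t (y - x))

/-- The terms of the perturbation series: `p^{(0)} = p` and
`p^{(n)}_t(x, y) = ∫_0^t ∫_X p_s(x, z) q(z) p^{(n-1)}_{t-s}(z, y) m(dz) ds` for `n ≥ 1`. -/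
noncomputable def perturbationTerm {X : Type*} [MeasurableSpace X] (m : Measure X)
    (p : ℝ → X → X → ℝ≥0∞) (q : X → ℝ≥0∞) : ℕ → ℝ → X → X → ℝ≥0∞
  | 0 => p
  | n + 1 => fun t x y =>
      ∫⁻ s in Set.Ioo 0 t, ∫⁻ z, p s x z * q z * perturbationTerm m p q n (t - s) z y ∂m

/-- The Schrödinger perturbation `∑_n p^{(n)}` of the transition density `p` by `q`. -/
noncomputable def schrodingerPerturbation {X : Type*} [MeasurableSpace X] (m : Measure X)
    (p : ℝ → X → X → ℝ≥0∞) (q : X → ℝ≥0∞) (t : ℝ) (x y : X) : ℝ≥0∞ :=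
  ∑' n : ℕ, perturbationTerm m p q n t x y

/-- The coefficient of the Hardy potential: `4^{α/2} Γ(d/2 - αβ/2) Γ(α(β+1)/2)` divided by
`Γ(d/2 - α(β+1)/2) Γ(αβ/2)`. -/
noncomputable def hardyCoefficient (d : ℕ) (α β : ℝ) : ℝ :=
  (4 ^ (α / 2) * Real.Gamma (d / 2 - α * β / 2) * Real.Gamma (α * (β + 1) / 2)) /
    (Real.Gamma (d / 2 - α * (β + 1) / 2) * Real.Gamma (α * β / 2))

/-- The potential `q(x) = C |x|^{-α}`, with values in `[0, ∞]`. -/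
noncomputable def hardyPotential (d : ℕ) (α β : ℝ) (x : EuclideanSpace ℝ (Fin d)) : ℝ≥0∞ :=
  ENNReal.ofReal (hardyCoefficient d α β) * ‖x‖ₑ ^ (-α)

/-!
Powers of the norm are time-weighted potentials of the stable semigroup. For `β > -1` put
`h_β(x) = ∫_0^∞ s ^ β p_s(x, 0) ds`. Scaling and rotation invariance of `p` make `h_β` a multiple
`K_β |x| ^ (-r)` with `r = d - α (β + 1)`, and comparing both sides after integration against a
Gaussian evaluates `K_β` by Gamma functions (`weightedPotential_eq`).

By the semigroup property, `P_t h_β(x) = ∫ (s - t)_+ ^ β p_s(x, 0) ds`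
(`lintegral_stableKernel_mul_weightedPotential`), which is at most `h_β(x)` if `β ≥ 0`,
since the weight is then nondecreasing. This is the unperturbed inequality, except for `r = 0`,
where it says that `p_t` has mass at most one.

For the perturbed inequality, the Hardy potential is `q = β h_{β-1} / h_β`
(`mul_potentialConstant_sub_one`), and the fundamental theorem of calculus for `s ↦ s_+ ^ β` gives
`P_t h_β + ∫_0^t P_s (q h_β) ds = h_β` (`lintegral_weightedPotential_add_lintegral`). An induction
over the partial sums of the perturbation series turns this into the bound for the whole series
(`lintegral_schrodingerPerturbation_mul_le`).

What remains is that `p_t`, given as a Fourier integral, is a nonnegative integrable convolution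
semigroup. Nonnegativity (`stableDensity_nonneg`) is the positive definiteness of
`exp (-t |ξ| ^ α)`: the Lévy–Khintchine formula writes `|ξ| ^ α` as a limit of `G(0) - G(|ξ| ^ 2)`
with `G` a positive mixture of exponentials `exp (-s |ξ| ^ 2)`, and
`exp (κ (G - G(0))) = lim (1 + κ (G - G(0)) / n) ^ n` is a limit of positive combinations of
Gaussians. Integrability follows by pairing with wide Gaussians, and the semigroup property by
Fourier inversion.
-/

/-! ### Positive definiteness of the stable characteristic function -/

section Positivity

open Filter Topology Set

variable {V : Type*} [NormedAddCommGroup V] [InnerProductSpace ℝ V] [FiniteDimensional ℝ V]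
  [MeasurableSpace V] [BorelSpace V]

lemma integrable_exp_neg_mul_sq_norm {δ : ℝ} (hδ : 0 < δ) :
    Integrable (fun ξ : V => Real.exp (-δ * ‖ξ‖ ^ 2)) := by
  have h := GaussianFourier.integrable_cexp_neg_mul_sq_norm_add (V := V) (b := (δ : ℂ))
    (by simpa using hδ) 0 0
  refine h.re.congr (ae_of_all _ fun ξ => ?_)
  simp only [zero_mul, add_zero]
  rw [← Complex.ofReal_pow, ← Complex.ofReal_neg, ← Complex.ofReal_mul]
  exact Complex.exp_ofReal_re _

lemma integral_cos_inner_mul_exp_neg_mul_sq_norm {δ : ℝ} (hδ : 0 < δ) (x : V) :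
    ∫ ξ : V, Real.cos (inner ℝ ξ x) * Real.exp (-δ * ‖ξ‖ ^ 2)
      = (Real.pi / δ) ^ (Module.finrank ℝ V / 2 : ℝ) * Real.exp (-‖x‖ ^ 2 / (4 * δ)) := by
  have hb : 0 < (δ : ℂ).re := by simpa using hδ
  have h := GaussianFourier.integral_cexp_neg_mul_sq_norm_add (V := V) hb Complex.I x
  have hi := GaussianFourier.integrable_cexp_neg_mul_sq_norm_add (V := V) hb Complex.I x
  have h2 := congrArg Complex.re h
  have h3 := integral_re hi
  simp only [RCLike.re_to_complex] at h3
  rw [← h3] at h2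
  convert h2 using 1
  · refine integral_congr_ae (ae_of_all _ fun ξ => ?_)
    simp only
    rw [Complex.exp_re]
    simp [← Complex.ofReal_pow, real_inner_comm, mul_comm]
  · have e1 : ((Real.pi : ℂ) / δ) ^ (Module.finrank ℝ V / 2 : ℂ)
        = (((Real.pi / δ) ^ (Module.finrank ℝ V / 2 : ℝ) : ℝ) : ℂ) := by
      rw [Complex.ofReal_cpow (by positivity)]
      push_cast
      rfl
    have e2 : Complex.I ^ 2 * (‖x‖ : ℂ) ^ 2 / (4 * δ) = ((-‖x‖ ^ 2 / (4 * δ) : ℝ) : ℂ) := by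
      push_cast
      rw [Complex.I_sq]
      ring
    rw [e1, e2, ← Complex.ofReal_exp, ← Complex.ofReal_mul, Complex.ofReal_re]

/-- A function `φ` whose product with any centred Gaussian has a nonnegative cosine transform.
For bounded continuous even functions this is a form of positive definiteness. -/
def IsGaussPositive (φ : V → ℝ) : Prop :=
  ∀ δ : ℝ, 0 < δ → ∀ x : V,
    0 ≤ ∫ ξ : V, Real.cos (inner ℝ ξ x) * (Real.exp (-δ * ‖ξ‖ ^ 2) * φ ξ)

lemma isGaussPositive_one : IsGaussPositive (fun _ : V => (1 : ℝ)) := by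
  intro δ hδ x
  simp only [mul_one]
  rw [integral_cos_inner_mul_exp_neg_mul_sq_norm hδ]
  positivity

lemma abs_cos_mul_le (a b : ℝ) : |Real.cos a * b| ≤ |b| := by
  rw [abs_mul]
  exact mul_le_of_le_one_left (abs_nonneg _) (Real.abs_cos_le_one a)

lemma integrable_cos_mul_exp_mul {φ : V → ℝ} (hφ : Measurable φ) {C : ℝ}
    (hC : ∀ ξ, |φ ξ| ≤ C) {δ : ℝ} (hδ : 0 < δ) (x : V) :
    Integrable (fun ξ : V => Real.cos (inner ℝ ξ x) * (Real.exp (-δ * ‖ξ‖ ^ 2) * φ ξ)) := by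
  refine ((integrable_exp_neg_mul_sq_norm (V := V) hδ).mul_const C).mono'
    (by fun_prop) (ae_of_all _ fun ξ => ?_)
  rw [Real.norm_eq_abs]
  refine (abs_cos_mul_le _ _).trans ?_
  rw [abs_mul, Real.abs_exp]
  exact mul_le_mul_of_nonneg_left (hC ξ) (Real.exp_pos _).le

/-- Dominated pointwise limits preserve Gauss positivity; the Gaussian factor is the integrable
majorant. -/
lemma IsGaussPositive.of_tendsto {φ : ℕ → V → ℝ} {ψ : V → ℝ}
    (h : ∀ᶠ n in atTop, IsGaussPositive (φ n)) (hm : ∀ n, Measurable (φ n))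
    (hb : ∀ᶠ n in atTop, ∀ ξ, |φ n ξ| ≤ 1)
    (hlim : ∀ ξ, Tendsto (fun n => φ n ξ) atTop (𝓝 (ψ ξ))) : IsGaussPositive ψ := by
  intro δ hδ x
  refine ge_of_tendsto (tendsto_integral_filter_of_dominated_convergence
    (F := fun n ξ => Real.cos (inner ℝ ξ x) * (Real.exp (-δ * ‖ξ‖ ^ 2) * φ n ξ))
    (fun ξ => Real.exp (-δ * ‖ξ‖ ^ 2)) ?_ ?_ (integrable_exp_neg_mul_sq_norm hδ) ?_)
    (h.mono fun n hn => hn δ hδ x)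
  · exact Eventually.of_forall fun n => by have := hm n; fun_prop
  · refine hb.mono fun n hn => ae_of_all _ fun ξ => ?_
    rw [Real.norm_eq_abs]
    refine (abs_cos_mul_le _ _).trans ?_
    rw [abs_mul, Real.abs_exp]
    exact mul_le_of_le_one_right (Real.exp_pos _).le (hn ξ)
  · exact ae_of_all _ fun ξ => ((hlim ξ).const_mul _).const_mul _

/-- The Laplace transform of the Lévy measure `s ^ (-1 - a) ds` of the `a`-stable subordinator,
with the jumps smaller than `ε` removed. -/
noncomputable def truncatedLevyLaplace (a ε u : ℝ) : ℝ :=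
  ∫ s in Ioi ε, Real.exp (-s * u) * s ^ (-1 - a)

lemma integrableOn_Ioi_rpow_levy {a ε : ℝ} (ha : 0 < a) (hε : 0 < ε) :
    IntegrableOn (fun s : ℝ => s ^ (-1 - a)) (Ioi ε) :=
  integrableOn_Ioi_rpow_of_lt (by linarith) hε

lemma integrableOn_exp_mul_rpow_levy {a ε u : ℝ} (ha : 0 < a) (hε : 0 < ε) (hu : 0 ≤ u) :
    IntegrableOn (fun s : ℝ => Real.exp (-s * u) * s ^ (-1 - a)) (Ioi ε) := by
  refine (integrableOn_Ioi_rpow_levy ha hε).mono' (by fun_prop) ?_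
  refine (ae_restrict_mem measurableSet_Ioi).mono fun s hs => ?_
  have hs0 : 0 < s := hε.trans hs
  rw [Real.norm_eq_abs, abs_of_nonneg (by positivity)]
  refine mul_le_of_le_one_left (by positivity) (Real.exp_le_one_iff.2 ?_)
  nlinarith

lemma truncatedLevyLaplace_nonneg {a ε : ℝ} (hε : 0 < ε) (u : ℝ) :
    0 ≤ truncatedLevyLaplace a ε u := by
  refine setIntegral_nonneg measurableSet_Ioi fun s hs => ?_
  have hs0 : 0 < s := hε.trans hs
  positivity

lemma truncatedLevyLaplace_le_zero {a ε u : ℝ} (ha : 0 < a) (hε : 0 < ε) (hu : 0 ≤ u) :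
    truncatedLevyLaplace a ε u ≤ truncatedLevyLaplace a ε 0 := by
  refine setIntegral_mono_on (integrableOn_exp_mul_rpow_levy ha hε hu)
    (integrableOn_exp_mul_rpow_levy ha hε le_rfl) measurableSet_Ioi fun s hs => ?_
  have hs0 : 0 < s := hε.trans hs
  refine mul_le_mul_of_nonneg_right (Real.exp_le_exp.2 ?_) (by positivity)
  nlinarith

lemma measurable_truncatedLevyLaplace (a ε : ℝ) : Measurable (truncatedLevyLaplace a ε) := by
  have : StronglyMeasurable (fun p : ℝ × ℝ => Real.exp (-p.2 * p.1) * p.2 ^ (-1 - a)) :=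
    Measurable.stronglyMeasurable (by fun_prop)
  exact (this.integral_prod_right (ν := volume.restrict (Ioi ε))).measurable

/-- Multiplying by the mixture `∫ exp (-s |ξ| ^ 2) s ^ (-1 - a) ds` of Gaussians only raises the
parameter `δ` in the definition of Gauss positivity, which is universally quantified. -/
lemma IsGaussPositive.mul_truncatedLevyLaplace {φ : V → ℝ} (h : IsGaussPositive φ)
    (hφ : Measurable φ) {C : ℝ} (hC : ∀ ξ, |φ ξ| ≤ C) {a ε : ℝ} (ha : 0 < a) (hε : 0 < ε) :
    IsGaussPositive (fun ξ => φ ξ * truncatedLevyLaplace a ε (‖ξ‖ ^ 2)) := by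
  intro δ hδ x
  have key : Integrable (Function.uncurry fun (ξ : V) (s : ℝ) =>
      Real.cos (inner ℝ ξ x) * (Real.exp (-δ * ‖ξ‖ ^ 2) * φ ξ) *
        (Real.exp (-s * ‖ξ‖ ^ 2) * s ^ (-1 - a))) (volume.prod (volume.restrict (Ioi ε))) := by
    have h1 := (integrable_cos_mul_exp_mul hφ hC hδ x).mul_prod (integrableOn_Ioi_rpow_levy ha hε)
    refine h1.norm.mono' (by unfold Function.uncurry; fun_prop) ?_
    have hmem : ∀ᵐ p : V × ℝ ∂(volume.prod (volume.restrict (Ioi ε))), p.2 ∈ Ioi ε :=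
      Measure.quasiMeasurePreserving_snd.ae (ae_restrict_mem measurableSet_Ioi)
    refine hmem.mono fun p hp => ?_
    have hs0 : 0 < p.2 := hε.trans hp
    simp only [Function.uncurry, norm_mul]
    refine mul_le_mul_of_nonneg_left (mul_le_of_le_one_left (norm_nonneg _) ?_) (by positivity)
    rw [Real.norm_eq_abs, Real.abs_exp]
    refine Real.exp_le_one_iff.2 ?_
    have := sq_nonneg ‖p.1‖
    nlinarith
  have swap : ∫ ξ : V, Real.cos (inner ℝ ξ x) *
      (Real.exp (-δ * ‖ξ‖ ^ 2) * (φ ξ * truncatedLevyLaplace a ε (‖ξ‖ ^ 2)))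
      = ∫ s in Ioi ε, ∫ ξ : V, Real.cos (inner ℝ ξ x) * (Real.exp (-δ * ‖ξ‖ ^ 2) * φ ξ) *
        (Real.exp (-s * ‖ξ‖ ^ 2) * s ^ (-1 - a)) := by
    rw [← integral_integral_swap key]
    refine integral_congr_ae (ae_of_all _ fun ξ => ?_)
    simp only
    rw [integral_const_mul, truncatedLevyLaplace]
    ring
  rw [swap]
  refine setIntegral_nonneg measurableSet_Ioi fun s hs => ?_
  have hs0 : 0 < s := hε.trans hs
  have e : ∀ ξ : V, Real.cos (inner ℝ ξ x) * (Real.exp (-δ * ‖ξ‖ ^ 2) * φ ξ) *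
        (Real.exp (-s * ‖ξ‖ ^ 2) * s ^ (-1 - a))
      = s ^ (-1 - a) * (Real.cos (inner ℝ ξ x) * (Real.exp (-(δ + s) * ‖ξ‖ ^ 2) * φ ξ)) := by
    intro ξ
    rw [show -(δ + s) * ‖ξ‖ ^ 2 = -δ * ‖ξ‖ ^ 2 + -s * ‖ξ‖ ^ 2 by ring, Real.exp_add]
    ring
  simp_rw [e]
  rw [integral_const_mul]
  exact mul_nonneg (by positivity) (h _ (by positivity) x)

lemma IsGaussPositive.pow_add_mul_truncatedLevyLaplace {a ε : ℝ} (ha : 0 < a) (hε : 0 < ε)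
    {A B : ℝ} (hA : 0 ≤ A) (hB : 0 ≤ B) (n : ℕ) :
    IsGaussPositive (fun ξ : V => (A + B * truncatedLevyLaplace a ε (‖ξ‖ ^ 2)) ^ n) := by
  have hmG := measurable_truncatedLevyLaplace a ε
  induction n with
  | zero => simpa using isGaussPositive_one
  | succ n ih =>
    set φ : V → ℝ := fun ξ => (A + B * truncatedLevyLaplace a ε (‖ξ‖ ^ 2)) ^ n with hφ
    have hm : Measurable φ := by fun_prop
    have hb : ∀ ξ, |φ ξ| ≤ (A + B * truncatedLevyLaplace a ε 0) ^ n := by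
      intro ξ
      have h0 := truncatedLevyLaplace_nonneg (a := a) hε (‖ξ‖ ^ 2)
      have h1 := truncatedLevyLaplace_le_zero ha hε (sq_nonneg ‖ξ‖)
      rw [hφ]
      simp only
      rw [abs_of_nonneg (by positivity)]
      gcongr
    have hmul := ih.mul_truncatedLevyLaplace hm hb ha hε
    intro δ hδ x
    have hbG : ∀ ξ : V, |φ ξ * truncatedLevyLaplace a ε (‖ξ‖ ^ 2)|
        ≤ (A + B * truncatedLevyLaplace a ε 0) ^ n * truncatedLevyLaplace a ε 0 := by
      intro ξ
      rw [abs_mul, abs_of_nonneg (truncatedLevyLaplace_nonneg hε _)]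
      exact mul_le_mul (hb ξ) (truncatedLevyLaplace_le_zero ha hε (sq_nonneg _))
        (truncatedLevyLaplace_nonneg hε _) ((abs_nonneg _).trans (hb ξ))
    have e : ∀ ξ : V, Real.cos (inner ℝ ξ x) * (Real.exp (-δ * ‖ξ‖ ^ 2) *
          (A + B * truncatedLevyLaplace a ε (‖ξ‖ ^ 2)) ^ (n + 1))
        = A * (Real.cos (inner ℝ ξ x) * (Real.exp (-δ * ‖ξ‖ ^ 2) * φ ξ))
          + B * (Real.cos (inner ℝ ξ x) * (Real.exp (-δ * ‖ξ‖ ^ 2) *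
            (φ ξ * truncatedLevyLaplace a ε (‖ξ‖ ^ 2)))) := by
      intro ξ
      simp only [hφ]
      ring
    simp_rw [e]
    rw [integral_add ((integrable_cos_mul_exp_mul hm hb hδ x).const_mul A)
      ((integrable_cos_mul_exp_mul (by fun_prop) hbG hδ x).const_mul B),
      integral_const_mul, integral_const_mul]
    exact add_nonneg (mul_nonneg hA (ih δ hδ x)) (mul_nonneg hB (hmul δ hδ x))

/-- The Fourier transform of a compound Poisson law is positive definite: it is the limit of
`(1 + (G - G 0) / n) ^ n`. -/
lemma isGaussPositive_exp_truncatedLevyLaplace {a ε : ℝ} (ha : 0 < a) (hε : 0 < ε)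
    {κ : ℝ} (hκ : 0 ≤ κ) :
    IsGaussPositive (fun ξ : V => Real.exp
      (-(κ * (truncatedLevyLaplace a ε 0 - truncatedLevyLaplace a ε (‖ξ‖ ^ 2))))) := by
  have hmG := measurable_truncatedLevyLaplace a ε
  set c := κ * truncatedLevyLaplace a ε 0 with hc
  -- for `n ≥ κ G(0)` the constant coefficient of `1 + κ (G - G(0)) / n` is nonnegative
  have hev : ∀ᶠ n : ℕ in atTop, c ≤ n ∧ 0 < (n : ℝ) :=
    (tendsto_natCast_atTop_atTop.eventually_ge_atTop c).and
      (tendsto_natCast_atTop_atTop.eventually_gt_atTop 0)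
  refine IsGaussPositive.of_tendsto (φ := fun n ξ =>
    ((1 - c / n) + (κ / n) * truncatedLevyLaplace a ε (‖ξ‖ ^ 2)) ^ n) ?_ ?_ ?_ ?_
  · refine hev.mono fun n hn => ?_
    refine IsGaussPositive.pow_add_mul_truncatedLevyLaplace ha hε ?_ (by positivity) n
    rw [sub_nonneg, div_le_one hn.2]
    exact hn.1
  · intro n
    fun_prop
  · refine hev.mono fun n hn ξ => ?_
    have h0 := truncatedLevyLaplace_nonneg (a := a) hε (‖ξ‖ ^ 2)
    have h1 := truncatedLevyLaplace_le_zero ha hε (sq_nonneg ‖ξ‖)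
    have h2 : c / n ≤ 1 := (div_le_one hn.2).2 hn.1
    have h3 : 0 ≤ (1 - c / n) + (κ / n) * truncatedLevyLaplace a ε (‖ξ‖ ^ 2) :=
      add_nonneg (by linarith) (mul_nonneg (by positivity) h0)
    rw [abs_of_nonneg (pow_nonneg h3 n)]
    refine pow_le_one₀ h3 ?_
    have : (κ / n) * truncatedLevyLaplace a ε (‖ξ‖ ^ 2) ≤ c / n := by
      rw [hc, div_mul_eq_mul_div]
      gcongr
    linarith
  · intro ξ
    have := Real.tendsto_one_add_div_pow_exp
      (-(κ * (truncatedLevyLaplace a ε 0 - truncatedLevyLaplace a ε (‖ξ‖ ^ 2))))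
    refine this.congr fun n => ?_
    congr 1
    rw [hc]
    ring

lemma one_sub_exp_neg_nonneg {s : ℝ} (hs : 0 ≤ s) : 0 ≤ 1 - Real.exp (-s) := by
  have := Real.exp_le_one_iff.2 (neg_nonpos.2 hs)
  linarith

lemma integrableOn_one_sub_exp_mul_rpow {a : ℝ} (ha : 0 < a) (ha1 : a < 1) :
    IntegrableOn (fun s : ℝ => (1 - Real.exp (-s)) * s ^ (-1 - a)) (Ioi 0) := by
  rw [← Ioc_union_Ioi_eq_Ioi zero_le_one]
  refine IntegrableOn.union ?_ ?_
  · have h : IntegrableOn (fun s : ℝ => s ^ (-a)) (Ioc 0 1) := by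
      have := intervalIntegral.intervalIntegrable_rpow' (a := 0) (b := 1) (r := -a) (by linarith)
      rwa [intervalIntegrable_iff_integrableOn_Ioc_of_le zero_le_one] at this
    refine h.mono' (by fun_prop) ((ae_restrict_mem measurableSet_Ioc).mono fun s hs => ?_)
    have hs0 : 0 < s := hs.1
    rw [Real.norm_eq_abs, abs_of_nonneg (mul_nonneg (one_sub_exp_neg_nonneg hs0.le)
      (by positivity))]
    have h1 : 1 - Real.exp (-s) ≤ s := by linarith [Real.add_one_le_exp (-s)]
    calc (1 - Real.exp (-s)) * s ^ (-1 - a) ≤ s * s ^ (-1 - a) := by gcongr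
      _ = s ^ (-a) := by
        rw [← Real.rpow_one_add' hs0.le (by linarith)]
        congr 1
        ring
  · refine (integrableOn_Ioi_rpow_levy ha one_pos).mono' (by fun_prop)
      ((ae_restrict_mem measurableSet_Ioi).mono fun s hs => ?_)
    have hs0 : 0 < s := one_pos.trans hs
    rw [Real.norm_eq_abs, abs_of_nonneg (mul_nonneg (one_sub_exp_neg_nonneg hs0.le)
      (by positivity))]
    exact mul_le_of_le_one_left (by positivity) (by linarith [Real.exp_pos (-s)])

lemma integral_one_sub_exp_mul_rpow_pos {a : ℝ} (ha : 0 < a) (ha1 : a < 1) :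
    0 < ∫ s in Ioi (0 : ℝ), (1 - Real.exp (-s)) * s ^ (-1 - a) := by
  have hpos : ∀ s ∈ Ioi (0 : ℝ), 0 < (1 - Real.exp (-s)) * s ^ (-1 - a) := by
    intro s hs
    have hs0 : 0 < s := hs
    refine mul_pos ?_ (by positivity)
    have := Real.exp_lt_one_iff.2 (neg_lt_zero.2 hs0)
    linarith
  rw [setIntegral_pos_iff_support_of_nonneg_ae
    ((ae_restrict_mem measurableSet_Ioi).mono fun s hs => (hpos s hs).le)
    (integrableOn_one_sub_exp_mul_rpow ha ha1)]
  refine lt_of_lt_of_le (b := volume (Ioi (0 : ℝ))) (by simp) (measure_mono fun s hs => ?_)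
  exact ⟨(hpos s hs).ne', hs⟩

lemma integral_one_sub_exp_mul_mul_rpow {a u : ℝ} (ha : 0 < a) (hu : 0 ≤ u) :
    ∫ s in Ioi (0 : ℝ), (1 - Real.exp (-s * u)) * s ^ (-1 - a)
      = u ^ a * ∫ s in Ioi (0 : ℝ), (1 - Real.exp (-s)) * s ^ (-1 - a) := by
  rcases hu.eq_or_lt with rfl | hu
  · simp [Real.zero_rpow ha.ne']
  have h := integral_comp_mul_left_Ioi (fun s => (1 - Real.exp (-s)) * s ^ (-1 - a)) 0 hu
  rw [mul_zero, smul_eq_mul] at h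
  have h2 : ∫ s in Ioi (0 : ℝ), (1 - Real.exp (-(u * s))) * (u * s) ^ (-1 - a)
      = u ^ (-1 - a) * ∫ s in Ioi (0 : ℝ), (1 - Real.exp (-s * u)) * s ^ (-1 - a) := by
    rw [← integral_const_mul]
    refine setIntegral_congr_fun measurableSet_Ioi fun s hs => ?_
    have hs0 : 0 < s := hs
    rw [Real.mul_rpow hu.le hs0.le, show -(u * s) = -s * u by ring]
    ring
  rw [h2] at h
  have h3 : u ^ a * u = u ^ (1 + a) := by rw [Real.rpow_one_add' hu.le (by linarith)]; ring
  have h4 : u ^ (1 + a) * u ^ (-1 - a) = 1 := by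
    rw [← Real.rpow_add hu, show 1 + a + (-1 - a) = 0 by ring, Real.rpow_zero]
  calc _ = (u ^ (1 + a) * u ^ (-1 - a)) *
        ∫ s in Ioi (0 : ℝ), (1 - Real.exp (-s * u)) * s ^ (-1 - a) := by rw [h4, one_mul]
    _ = u ^ (1 + a) * (u⁻¹ * ∫ s in Ioi (0 : ℝ), (1 - Real.exp (-s)) * s ^ (-1 - a)) := by
        rw [mul_assoc, h]
    _ = _ := by
        rw [← h3]
        field_simp

lemma integrableOn_one_sub_exp_mul_mul_rpow {a u : ℝ} (ha : 0 < a) (ha1 : a < 1) (hu : 0 ≤ u) :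
    IntegrableOn (fun s : ℝ => (1 - Real.exp (-s * u)) * s ^ (-1 - a)) (Ioi 0) := by
  rcases hu.eq_or_lt with rfl | hu
  · simp
  -- the integral was computed to be nonzero, while a divergent integral has the value zero
  refine not_imp_comm.1 integral_undef ?_
  rw [integral_one_sub_exp_mul_mul_rpow ha hu.le]
  exact (mul_pos (by positivity) (integral_one_sub_exp_mul_rpow_pos ha ha1)).ne'

/-- The Lévy–Khintchine formula of the `a`-stable subordinator: `u ^ a` is a multiple of
`∫_0^∞ (1 - exp (-s u)) s ^ (-1 - a) ds`, obtained here by letting the truncation tend to zero. -/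
lemma tendsto_truncatedLevyLaplace {a u : ℝ} (ha : 0 < a) (ha1 : a < 1) (hu : 0 ≤ u) :
    Tendsto (fun n : ℕ => truncatedLevyLaplace a (1 / (n + 1)) 0
        - truncatedLevyLaplace a (1 / (n + 1)) u) atTop
      (𝓝 (u ^ a * ∫ s in Ioi (0 : ℝ), (1 - Real.exp (-s)) * s ^ (-1 - a))) := by
  have hU : ⋃ n : ℕ, Ioi (1 / ((n : ℝ) + 1)) = Ioi 0 := by
    ext s
    simp only [mem_iUnion, mem_Ioi]
    refine ⟨fun ⟨n, hn⟩ => lt_trans (by positivity) hn, fun hs => exists_nat_one_div_lt hs⟩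
  have h := tendsto_setIntegral_of_monotone (μ := volume)
    (f := fun s : ℝ => (1 - Real.exp (-s * u)) * s ^ (-1 - a))
    (s := fun n : ℕ => Ioi (1 / ((n : ℝ) + 1))) (fun n => measurableSet_Ioi)
    (fun m n hmn => Ioi_subset_Ioi (Nat.one_div_le_one_div hmn))
    (by rw [hU]; exact integrableOn_one_sub_exp_mul_mul_rpow ha ha1 hu)
  rw [hU, integral_one_sub_exp_mul_mul_rpow ha hu] at h
  refine h.congr fun n => ?_
  have hε : 0 < 1 / ((n : ℝ) + 1) := by positivity
  rw [truncatedLevyLaplace, truncatedLevyLaplace,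
    ← integral_sub (integrableOn_exp_mul_rpow_levy ha hε le_rfl)
      (integrableOn_exp_mul_rpow_levy ha hε hu)]
  refine integral_congr_ae (ae_of_all _ fun s => ?_)
  simp only [mul_zero, Real.exp_zero]
  ring

/-- The characteristic function of the isotropic `α`-stable law is a limit of those of Gaussians
subordinated by compound Poisson laws. -/
lemma isGaussPositive_exp_neg_mul_norm_rpow {α t : ℝ} (hα0 : 0 < α) (hα2 : α < 2) (ht : 0 ≤ t) :
    IsGaussPositive (fun ξ : V => Real.exp (-t * ‖ξ‖ ^ α)) := by
  have ha : 0 < α / 2 := by linarith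
  have ha1 : α / 2 < 1 := by linarith
  set c := ∫ s in Ioi (0 : ℝ), (1 - Real.exp (-s)) * s ^ (-1 - α / 2) with hc
  have hc0 : 0 < c := integral_one_sub_exp_mul_rpow_pos ha ha1
  have hκ : 0 ≤ t / c := by positivity
  have hε : ∀ n : ℕ, 0 < 1 / ((n : ℝ) + 1) := fun n => by positivity
  refine IsGaussPositive.of_tendsto (φ := fun n ξ => Real.exp
      (-(t / c * (truncatedLevyLaplace (α / 2) (1 / (n + 1)) 0
        - truncatedLevyLaplace (α / 2) (1 / (n + 1)) (‖ξ‖ ^ 2)))))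
    (Eventually.of_forall fun n => isGaussPositive_exp_truncatedLevyLaplace ha (hε n) hκ)
    (fun n => ?_) (Eventually.of_forall fun n ξ => ?_) fun ξ => ?_
  · have := measurable_truncatedLevyLaplace (α / 2) (1 / ((n : ℝ) + 1))
    fun_prop
  · rw [Real.abs_exp]
    refine Real.exp_le_one_iff.2 (neg_nonpos.2 (mul_nonneg hκ (sub_nonneg.2 ?_)))
    exact truncatedLevyLaplace_le_zero ha (hε n) (sq_nonneg _)
  · have h := (tendsto_truncatedLevyLaplace ha ha1 (sq_nonneg ‖ξ‖)).const_mul (t / c)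
    have e : -t * ‖ξ‖ ^ α = -(t / c * ((‖ξ‖ ^ 2) ^ (α / 2) * c)) := by
      rw [← Real.rpow_natCast, ← Real.rpow_mul (norm_nonneg _),
        show ((2 : ℕ) : ℝ) * (α / 2) = α by push_cast; ring]
      field_simp
    rw [e]
    exact (Real.continuous_exp.tendsto _).comp h.neg

end Positivity

/-! ### The stable convolution semigroup -/

section Density

open Filter Topology

variable {d : ℕ} {α : ℝ}

lemma integrable_exp_neg_mul_norm_rpow (hd : 0 < d) (hα0 : 0 < α) {t : ℝ} (ht : 0 < t) :
    Integrable (fun ξ : EuclideanSpace ℝ (Fin d) => Real.exp (-t * ‖ξ‖ ^ α)) := by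
  have : Nonempty (Fin d) := ⟨⟨0, hd⟩⟩
  rw [integrable_fun_norm_addHaar volume (f := fun ρ : ℝ => Real.exp (-t * ρ ^ α))]
  refine (integrableOn_rpow_mul_exp_neg_mul_rpow (s := ((d - 1 : ℕ) : ℝ))
    (by linarith [Nat.cast_nonneg (α := ℝ) (d - 1)]) hα0 ht).congr_fun (fun ρ _ => ?_)
    measurableSet_Ioi
  simp

lemma stableDensity_nonneg (hd : 0 < d) (hα0 : 0 < α) (hα2 : α < 2) {t : ℝ} (ht : 0 < t)
    (x : EuclideanSpace ℝ (Fin d)) : 0 ≤ stableDensity d α t x := by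
  refine mul_nonneg (by positivity) ?_
  refine ge_of_tendsto (tendsto_integral_of_dominated_convergence
    (F := fun (n : ℕ) ξ => Real.cos (inner ℝ ξ x) *
      (Real.exp (-(1 / ((n : ℝ) + 1)) * ‖ξ‖ ^ 2) * Real.exp (-t * ‖ξ‖ ^ α)))
    (fun ξ => Real.exp (-t * ‖ξ‖ ^ α)) (fun n => by fun_prop)
    (integrable_exp_neg_mul_norm_rpow hd hα0 ht) (fun n => ae_of_all _ fun ξ => ?_)
    (ae_of_all _ fun ξ => ?_))
    (Eventually.of_forall fun n =>
      isGaussPositive_exp_neg_mul_norm_rpow hα0 hα2 ht.le _ (by positivity) x)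
  · rw [Real.norm_eq_abs]
    refine (abs_cos_mul_le _ _).trans ?_
    rw [abs_mul, Real.abs_exp, Real.abs_exp]
    refine mul_le_of_le_one_left (Real.exp_pos _).le (Real.exp_le_one_iff.2 ?_)
    have : 0 ≤ 1 / ((n : ℝ) + 1) * ‖ξ‖ ^ 2 := by positivity
    linarith
  · have h := ((tendsto_one_div_add_atTop_nhds_zero_nat (𝕜 := ℝ)).neg.mul_const (‖ξ‖ ^ 2))
    have h2 := (Real.continuous_exp.tendsto _).comp h
    simp only [neg_zero, zero_mul, Real.exp_zero] at h2
    have h3 := (h2.mul_const (Real.exp (-t * ‖ξ‖ ^ α))).const_mul (Real.cos (inner ℝ ξ x))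
    rwa [one_mul] at h3

lemma measurable_stableDensity_uncurry (d : ℕ) (α : ℝ) :
    Measurable (fun p : ℝ × EuclideanSpace ℝ (Fin d) => stableDensity d α p.1 p.2) := by
  have h : StronglyMeasurable (fun p : (ℝ × EuclideanSpace ℝ (Fin d)) × EuclideanSpace ℝ (Fin d) =>
      Real.cos (inner ℝ p.2 p.1.2) * Real.exp (-p.1.1 * ‖p.2‖ ^ α)) :=
    Measurable.stronglyMeasurable (by fun_prop)
  exact (h.integral_prod_right (ν := volume)).measurable.const_mul _

lemma measurable_stableDensity (d : ℕ) (α t : ℝ) : Measurable (stableDensity d α t) := by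
  have h := (measurable_stableDensity_uncurry d α).comp (measurable_prodMk_left (x := t))
  simp only [Function.comp_def] at h
  exact h

lemma abs_stableDensity_le (hd : 0 < d) (hα0 : 0 < α) {t : ℝ} (ht : 0 < t)
    (x : EuclideanSpace ℝ (Fin d)) : |stableDensity d α t x| ≤ ((2 * Real.pi) ^ d)⁻¹ *
      ∫ ξ : EuclideanSpace ℝ (Fin d), Real.exp (-t * ‖ξ‖ ^ α) := by
  rw [stableDensity, abs_mul, abs_of_nonneg (by positivity)]
  refine mul_le_mul_of_nonneg_left ?_ (by positivity)
  refine (abs_integral_le_integral_abs).trans (integral_mono_of_nonneg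
    (ae_of_all _ fun _ => abs_nonneg _) (integrable_exp_neg_mul_norm_rpow hd hα0 ht)
    (ae_of_all _ fun ξ => ?_))
  exact (abs_cos_mul_le _ _).trans (by rw [Real.abs_exp])

/-- The pairing of the stable density with a function `f` may be computed on the Fourier side. -/
lemma integral_mul_stableDensity_sub (hd : 0 < d) (hα0 : 0 < α) {t : ℝ} (ht : 0 < t)
    {f : EuclideanSpace ℝ (Fin d) → ℝ} (hf : Integrable f) (y : EuclideanSpace ℝ (Fin d)) :
    ∫ x, f x * stableDensity d α t (y - x) = ((2 * Real.pi) ^ d)⁻¹ *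
      ∫ ξ : EuclideanSpace ℝ (Fin d),
        Real.exp (-t * ‖ξ‖ ^ α) * ∫ x, f x * Real.cos (inner ℝ ξ (y - x)) := by
  have hint : Integrable (Function.uncurry fun x ξ : EuclideanSpace ℝ (Fin d) =>
      f x * (Real.cos (inner ℝ ξ (y - x)) * Real.exp (-t * ‖ξ‖ ^ α)))
      (volume.prod volume) := by
    have h1 := hf.mul_prod (integrable_exp_neg_mul_norm_rpow (α := α) hd hα0 ht)
    refine h1.mono (hf.aestronglyMeasurable.comp_fst.mul (by
      apply Measurable.aestronglyMeasurable
      fun_prop)) (ae_of_all _ fun p => ?_)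
    simp only [Function.uncurry, norm_mul]
    refine mul_le_mul_of_nonneg_left ?_ (norm_nonneg _)
    exact mul_le_of_le_one_left (norm_nonneg _) (Real.abs_cos_le_one _)
  calc ∫ x, f x * stableDensity d α t (y - x)
      = ((2 * Real.pi) ^ d)⁻¹ * ∫ x, ∫ ξ : EuclideanSpace ℝ (Fin d),
          f x * (Real.cos (inner ℝ ξ (y - x)) * Real.exp (-t * ‖ξ‖ ^ α)) := by
        rw [← integral_const_mul]
        refine integral_congr_ae (ae_of_all _ fun x => ?_)
        simp only [stableDensity]
        rw [integral_const_mul]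
        ring
    _ = _ := by
        rw [integral_integral_swap hint]
        congr 1
        refine integral_congr_ae (ae_of_all _ fun ξ => ?_)
        simp only
        rw [← integral_const_mul]
        refine integral_congr_ae (ae_of_all _ fun x => ?_)
        simp only
        ring

lemma stableDensity_neg (t : ℝ) (x : EuclideanSpace ℝ (Fin d)) :
    stableDensity d α t (-x) = stableDensity d α t x := by
  simp [stableDensity]

lemma integral_exp_neg_mul_sq_norm_mul_stableDensity (hd : 0 < d) (hα0 : 0 < α) {t : ℝ}
    (ht : 0 < t) {ε : ℝ} (hε : 0 < ε) :
    ∫ x, Real.exp (-ε * ‖x‖ ^ 2) * stableDensity d α t x = ((2 * Real.pi) ^ d)⁻¹ *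
      (Real.pi / ε) ^ (d / 2 : ℝ) * ∫ ξ : EuclideanSpace ℝ (Fin d),
        Real.exp (-t * ‖ξ‖ ^ α) * Real.exp (-‖ξ‖ ^ 2 / (4 * ε)) := by
  have h := integral_mul_stableDensity_sub hd hα0 ht
    (integrable_exp_neg_mul_sq_norm (V := EuclideanSpace ℝ (Fin d)) hε) 0
  simp only [zero_sub, stableDensity_neg] at h
  rw [h, mul_assoc, ← integral_const_mul ((Real.pi / ε) ^ (d / 2 : ℝ))]
  congr 1
  refine integral_congr_ae (ae_of_all _ fun ξ => ?_)
  simp only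
  have h2 := integral_cos_inner_mul_exp_neg_mul_sq_norm (V := EuclideanSpace ℝ (Fin d)) hε ξ
  simp only [finrank_euclideanSpace, Fintype.card_fin] at h2
  have h3 : ∫ x, Real.exp (-ε * ‖x‖ ^ 2) * Real.cos (inner ℝ ξ (-x))
      = (Real.pi / ε) ^ (d / 2 : ℝ) * Real.exp (-‖ξ‖ ^ 2 / (4 * ε)) := by
    rw [← h2]
    refine integral_congr_ae (ae_of_all _ fun x => ?_)
    simp only [inner_neg_right, Real.cos_neg, real_inner_comm]
    ring
  rw [h3]
  ring

lemma integrable_exp_neg_mul_sq_norm_mul_stableDensity (hd : 0 < d) (hα0 : 0 < α) {t : ℝ}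
    (ht : 0 < t) {ε : ℝ} (hε : 0 < ε) :
    Integrable (fun x => Real.exp (-ε * ‖x‖ ^ 2) * stableDensity d α t x) :=
  (integrable_exp_neg_mul_sq_norm hε).mul_bdd (measurable_stableDensity d α t).aestronglyMeasurable
    (ae_of_all _ fun x => abs_stableDensity_le hd hα0 ht x)

lemma lintegral_exp_neg_mul_sq_norm_mul_stableDensity (hd : 0 < d) (hα0 : 0 < α) (hα2 : α < 2)
    {t : ℝ} (ht : 0 < t) {ε : ℝ} (hε : 0 < ε) :
    ∫⁻ x, ENNReal.ofReal (Real.exp (-ε * ‖x‖ ^ 2)) * ENNReal.ofReal (stableDensity d α t x)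
      = ENNReal.ofReal (((2 * Real.pi) ^ d)⁻¹ * (Real.pi / ε) ^ (d / 2 : ℝ)) *
        ∫⁻ ξ : EuclideanSpace ℝ (Fin d), ENNReal.ofReal
          (Real.exp (-t * ‖ξ‖ ^ α) * Real.exp (-‖ξ‖ ^ 2 / (4 * ε))) := by
  simp_rw [← ENNReal.ofReal_mul (Real.exp_pos _).le]
  have hi : Integrable (fun ξ : EuclideanSpace ℝ (Fin d) =>
      Real.exp (-t * ‖ξ‖ ^ α) * Real.exp (-‖ξ‖ ^ 2 / (4 * ε))) := by
    refine (integrable_exp_neg_mul_norm_rpow hd hα0 ht).mul_bdd (c := 1) (by fun_prop)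
      (ae_of_all _ fun ξ => ?_)
    rw [Real.norm_eq_abs, Real.abs_exp]
    refine Real.exp_le_one_iff.2 ?_
    rw [neg_div]
    exact neg_nonpos.2 (by positivity)
  rw [← ofReal_integral_eq_lintegral_ofReal
      (integrable_exp_neg_mul_sq_norm_mul_stableDensity hd hα0 ht hε)
      (ae_of_all _ fun x => mul_nonneg (Real.exp_pos _).le (stableDensity_nonneg hd hα0 hα2 ht x)),
    ← ofReal_integral_eq_lintegral_ofReal hi (ae_of_all _ fun ξ => by positivity),
    ← ENNReal.ofReal_mul (by positivity),
    integral_exp_neg_mul_sq_norm_mul_stableDensity hd hα0 ht hε]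

/-- Integrating `p_t` against `exp (-ε |x| ^ 2)` amounts to averaging `exp (-t |ξ| ^ α) ≤ 1` against
a Gaussian probability density; let `ε → 0` by Fatou's lemma. -/
lemma lintegral_stableDensity_le_one (hd : 0 < d) (hα0 : 0 < α) (hα2 : α < 2) {t : ℝ}
    (ht : 0 < t) : ∫⁻ x, ENNReal.ofReal (stableDensity d α t x) ≤ 1 := by
  set F : ℕ → EuclideanSpace ℝ (Fin d) → ℝ≥0∞ := fun n x =>
    ENNReal.ofReal (Real.exp (-(1 / ((n : ℝ) + 1)) * ‖x‖ ^ 2))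
      * ENNReal.ofReal (stableDensity d α t x) with hF
  have hmp := measurable_stableDensity d α t
  have hlim : ∀ x, Tendsto (fun n => F n x) atTop
      (𝓝 (ENNReal.ofReal (stableDensity d α t x))) := by
    intro x
    have h := ((tendsto_one_div_add_atTop_nhds_zero_nat (𝕜 := ℝ)).neg.mul_const (‖x‖ ^ 2))
    have h2 := ENNReal.tendsto_ofReal ((Real.continuous_exp.tendsto _).comp h)
    simp only [neg_zero, zero_mul, Real.exp_zero, ENNReal.ofReal_one] at h2
    have h3 := ENNReal.Tendsto.mul_const (b := ENNReal.ofReal (stableDensity d α t x)) h2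
      (Or.inl one_ne_zero)
    rwa [one_mul] at h3
  have hle : ∀ n, ∫⁻ x, F n x ≤ 1 := by
    intro n
    have hε : 0 < 1 / ((n : ℝ) + 1) := by positivity
    set ε := 1 / ((n : ℝ) + 1)
    rw [hF]
    simp only
    rw [lintegral_exp_neg_mul_sq_norm_mul_stableDensity hd hα0 hα2 ht hε]
    have hε4 : 0 < (4 * ε)⁻¹ := by positivity
    calc _ ≤ ENNReal.ofReal (((2 * Real.pi) ^ d)⁻¹ * (Real.pi / ε) ^ (d / 2 : ℝ)) *
          ∫⁻ ξ : EuclideanSpace ℝ (Fin d), ENNReal.ofReal (Real.exp (-(4 * ε)⁻¹ * ‖ξ‖ ^ 2)) := by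
          refine mul_le_mul_right (lintegral_mono fun ξ => ENNReal.ofReal_le_ofReal ?_) _
          rw [show -‖ξ‖ ^ 2 / (4 * ε) = -(4 * ε)⁻¹ * ‖ξ‖ ^ 2 by ring]
          refine mul_le_of_le_one_left (Real.exp_pos _).le (Real.exp_le_one_iff.2 ?_)
          have : 0 ≤ t * ‖ξ‖ ^ α := by positivity
          linarith
      _ = 1 := by
          rw [← ofReal_integral_eq_lintegral_ofReal (integrable_exp_neg_mul_sq_norm hε4)
            (ae_of_all _ fun ξ => by positivity),
            GaussianFourier.integral_rexp_neg_mul_sq_norm hε4,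
            ← ENNReal.ofReal_mul (by positivity), ENNReal.ofReal_eq_one]
          simp only [finrank_euclideanSpace, Fintype.card_fin]
          rw [mul_assoc, ← Real.mul_rpow (by positivity) (by positivity),
            show Real.pi / ε * (Real.pi / (4 * ε)⁻¹) = (2 * Real.pi) ^ (2 : ℝ) by
              rw [Real.rpow_two]; field_simp; ring,
            ← Real.rpow_mul (by positivity), show (2 : ℝ) * (d / 2) = d by ring,
            Real.rpow_natCast, inv_mul_cancel₀ (by positivity)]
  calc ∫⁻ x, ENNReal.ofReal (stableDensity d α t x)
      = ∫⁻ x, liminf (fun n => F n x) atTop :=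
        lintegral_congr fun x => (hlim x).liminf_eq.symm
    _ ≤ liminf (fun n => ∫⁻ x, F n x) atTop := lintegral_liminf_le fun n => by
        rw [hF]; fun_prop
    _ ≤ 1 := liminf_le_of_le (by isBoundedDefault) fun b hb =>
        hb.exists.elim fun n hn => hn.trans (hle n)

lemma integrable_stableDensity (hd : 0 < d) (hα0 : 0 < α) (hα2 : α < 2) {t : ℝ} (ht : 0 < t) :
    Integrable (stableDensity d α t) := by
  refine ⟨(measurable_stableDensity d α t).aestronglyMeasurable, ?_⟩
  rw [hasFiniteIntegral_iff_ofReal (ae_of_all _ (stableDensity_nonneg hd hα0 hα2 ht))]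
  exact (lintegral_stableDensity_le_one hd hα0 hα2 ht).trans_lt ENNReal.one_lt_top

lemma integral_eq_zero_of_odd {f : EuclideanSpace ℝ (Fin d) → ℝ} (hf : ∀ x, f (-x) = -f x) :
    ∫ x, f x = 0 := by
  have h := integral_neg_eq_self f volume
  simp_rw [hf] at h
  rw [integral_neg] at h
  linarith

open FourierTransform in
/-- `p_t` in terms of Mathlib's Fourier transform, whose characters are
`x ↦ exp (-2 π i ⟨η, x⟩)`. -/
lemma fourier_exp_neg_mul_norm_rpow (hd : 0 < d) (hα0 : 0 < α) {t : ℝ} (ht : 0 < t)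
    (x : EuclideanSpace ℝ (Fin d)) :
    𝓕 (fun η : EuclideanSpace ℝ (Fin d) =>
      ((Real.exp (-t * ‖(2 * Real.pi) • η‖ ^ α) : ℝ) : ℂ)) x = (stableDensity d α t x : ℂ) := by
  set f : EuclideanSpace ℝ (Fin d) → ℂ := fun ξ =>
    Complex.exp ((-inner ℝ ξ x : ℝ) * Complex.I) * (Real.exp (-t * ‖ξ‖ ^ α) : ℝ) with hf
  have h1 : 𝓕 (fun η : EuclideanSpace ℝ (Fin d) =>
      ((Real.exp (-t * ‖(2 * Real.pi) • η‖ ^ α) : ℝ) : ℂ)) x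
      = ∫ η, f ((2 * Real.pi) • η) := by
    rw [Real.fourier_eq']
    refine integral_congr_ae (ae_of_all _ fun η => ?_)
    simp only [hf, smul_eq_mul, real_inner_smul_left]
    congr 3
    ring_nf
  have hfi : Integrable f := by
    refine (integrable_exp_neg_mul_norm_rpow (α := α) hd hα0 ht).mono'
      (by apply Measurable.aestronglyMeasurable; fun_prop) (ae_of_all _ fun ξ => ?_)
    simp only [hf, norm_mul, Complex.norm_exp_ofReal_mul_I, one_mul, Complex.norm_real]
    rw [Real.norm_eq_abs, Real.abs_exp]
  have hre : ∀ ξ, (f ξ).re = Real.cos (inner ℝ ξ x) * Real.exp (-t * ‖ξ‖ ^ α) := by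
    intro ξ
    simp only [hf]
    rw [Complex.re_mul_ofReal, Complex.exp_ofReal_mul_I_re, Real.cos_neg]
  have him : ∀ ξ, (f ξ).im = -Real.sin (inner ℝ ξ x) * Real.exp (-t * ‖ξ‖ ^ α) := by
    intro ξ
    simp only [hf]
    rw [Complex.im_mul_ofReal, Complex.exp_ofReal_mul_I_im, Real.sin_neg]
  have h2 : ∫ ξ, f ξ
      = ((∫ ξ, Real.cos (inner ℝ ξ x) * Real.exp (-t * ‖ξ‖ ^ α) : ℝ) : ℂ) := by
    apply Complex.ext
    · rw [Complex.ofReal_re, ← RCLike.re_to_complex, ← integral_re hfi]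
      exact integral_congr_ae (ae_of_all _ hre)
    · rw [Complex.ofReal_im, ← RCLike.im_to_complex, ← integral_im hfi]
      refine integral_eq_zero_of_odd fun ξ => ?_
      simp only [RCLike.im_to_complex, him, inner_neg_left, Real.sin_neg, norm_neg]
      ring
  rw [h1, Measure.integral_comp_smul_of_nonneg volume f _ (hR := by positivity), h2,
    finrank_euclideanSpace, Fintype.card_fin, stableDensity, Complex.real_smul]
  push_cast
  rfl

/-- The stable density is a probability density with characteristic function
`η ↦ exp (-t |η| ^ α)`. -/
lemma integral_stableDensity_mul_cos (hd : 0 < d) (hα0 : 0 < α) (hα2 : α < 2) {t : ℝ}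
    (ht : 0 < t) (η : EuclideanSpace ℝ (Fin d)) :
    ∫ x, stableDensity d α t x * Real.cos (inner ℝ η x) = Real.exp (-t * ‖η‖ ^ α) := by
  set Φ : EuclideanSpace ℝ (Fin d) → ℂ := fun η =>
      ((Real.exp (-t * ‖(2 * Real.pi) • η‖ ^ α) : ℝ) : ℂ) with hΦ
  have hΦi : Integrable Φ :=
    ((integrable_exp_neg_mul_norm_rpow hd hα0 ht).comp_smul
      (by positivity : (2 * Real.pi) ≠ 0)).ofReal
  have hΦc : Continuous Φ := by
    have : Continuous fun η : EuclideanSpace ℝ (Fin d) => ‖(2 * Real.pi) • η‖ ^ α :=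
      (by fun_prop : Continuous fun η : EuclideanSpace ℝ (Fin d) =>
        ‖(2 * Real.pi) • η‖).rpow_const fun _ => Or.inr hα0.le
    fun_prop
  have hF : FourierTransform.fourier Φ = fun x => (stableDensity d α t x : ℂ) :=
    funext fun x => fourier_exp_neg_mul_norm_rpow hd hα0 ht x
  have hpi : Integrable (fun x => (stableDensity d α t x : ℂ)) :=
    (integrable_stableDensity hd hα0 hα2 ht).ofReal
  have hinv := hΦi.fourierInv_fourier_eq (v := (2 * Real.pi)⁻¹ • η)
    (hF ▸ hpi) hΦc.continuousAt
  rw [hF, Real.fourierInv_eq'] at hinv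
  have hre := congrArg Complex.re hinv
  rw [hΦ] at hre
  simp only at hre
  rw [Complex.ofReal_re, smul_inv_smul₀ (by positivity), ← RCLike.re_to_complex,
    ← integral_re] at hre
  · rw [← hre]
    refine integral_congr_ae (ae_of_all _ fun x => ?_)
    simp only [RCLike.re_to_complex, smul_eq_mul]
    rw [Complex.re_mul_ofReal, Complex.exp_ofReal_mul_I_re, inner_smul_right, mul_comm,
      real_inner_comm]
    congr 2
    field_simp
  · have hmp := measurable_stableDensity d α t
    refine hpi.norm.mono' ?_ (ae_of_all _ fun x => ?_)
    · apply Measurable.aestronglyMeasurable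
      fun_prop
    · rw [norm_smul, Complex.norm_exp_ofReal_mul_I, one_mul]

lemma integral_stableDensity_mul_sin (t : ℝ) (η : EuclideanSpace ℝ (Fin d)) :
    ∫ x, stableDensity d α t x * Real.sin (inner ℝ η x) = 0 :=
  integral_eq_zero_of_odd fun x => by
    rw [stableDensity_neg, inner_neg_right, Real.sin_neg]
    ring

/-- The semigroup property of the stable densities. -/
lemma integral_stableDensity_mul_stableDensity_sub (hd : 0 < d) (hα0 : 0 < α) (hα2 : α < 2)
    {s t : ℝ} (hs : 0 < s) (ht : 0 < t) (y : EuclideanSpace ℝ (Fin d)) :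
    ∫ x, stableDensity d α s x * stableDensity d α t (y - x) = stableDensity d α (s + t) y := by
  have hi := integrable_stableDensity hd hα0 hα2 hs
  rw [integral_mul_stableDensity_sub hd hα0 ht hi, stableDensity]
  congr 1
  refine integral_congr_ae (ae_of_all _ fun ξ => ?_)
  simp only
  have hb : ∀ g : ℝ → ℝ, Measurable g → (∀ a, |g a| ≤ 1) →
      Integrable fun x => stableDensity d α s x * g (inner ℝ ξ x) := fun g hg hg1 =>
    hi.mul_bdd (hg.comp (by fun_prop)).aestronglyMeasurable (ae_of_all _ fun x => hg1 _)
  have e : ∫ x, stableDensity d α s x * Real.cos (inner ℝ ξ (y - x))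
      = Real.cos (inner ℝ ξ y) * Real.exp (-s * ‖ξ‖ ^ α) := by
    have e1 : ∀ x, stableDensity d α s x * Real.cos (inner ℝ ξ (y - x))
        = Real.cos (inner ℝ ξ y) * (stableDensity d α s x * Real.cos (inner ℝ ξ x))
          + Real.sin (inner ℝ ξ y) * (stableDensity d α s x * Real.sin (inner ℝ ξ x)) := by
      intro x
      rw [inner_sub_right, Real.cos_sub]
      ring
    simp_rw [e1]
    rw [integral_add ((hb _ Real.measurable_cos Real.abs_cos_le_one).const_mul _)
      ((hb _ Real.measurable_sin Real.abs_sin_le_one).const_mul _),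
      integral_const_mul, integral_const_mul, integral_stableDensity_mul_cos hd hα0 hα2 hs,
      integral_stableDensity_mul_sin]
    ring
  rw [e, show -(s + t) * ‖ξ‖ ^ α = -s * ‖ξ‖ ^ α + -t * ‖ξ‖ ^ α by ring, Real.exp_add]
  ring

lemma stableDensity_smul (t : ℝ) {c : ℝ} (hc : 0 < c)
    (x : EuclideanSpace ℝ (Fin d)) :
    stableDensity d α (c ^ α * t) (c • x) = (c ^ d)⁻¹ * stableDensity d α t x := by
  have h := Measure.integral_comp_smul_of_nonneg (volume : Measure (EuclideanSpace ℝ (Fin d)))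
    (fun ξ => Real.cos (inner ℝ ξ x) * Real.exp (-t * ‖ξ‖ ^ α)) c (hR := hc.le)
  rw [finrank_euclideanSpace, Fintype.card_fin, smul_eq_mul] at h
  rw [stableDensity, stableDensity, mul_left_comm, ← h]
  congr 1
  refine integral_congr_ae (ae_of_all _ fun ξ => ?_)
  simp only
  rw [inner_smul_right, real_inner_smul_left, norm_smul, Real.norm_of_nonneg hc.le,
    Real.mul_rpow hc.le (norm_nonneg _)]
  ring_nf

lemma stableDensity_eq_of_norm_eq (t : ℝ) {x y : EuclideanSpace ℝ (Fin d)} (h : ‖x‖ = ‖y‖) :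
    stableDensity d α t x = stableDensity d α t y := by
  -- a reflection takes `x` to `y`, and the integrand depends on `ξ` only through `|ξ|`, `⟨ξ, x⟩`
  have hR := Submodule.reflection_sub h
  set R := (ℝ ∙ (x - y))ᗮ.reflection
  rw [stableDensity, stableDensity,
    ← R.measurePreserving.integral_comp R.toHomeomorph.measurableEmbedding
      (fun ξ => Real.cos (inner ℝ ξ y) * Real.exp (-t * ‖ξ‖ ^ α))]
  congr 1
  refine integral_congr_ae (ae_of_all _ fun ξ => ?_)
  simp only [LinearIsometryEquiv.norm_map]
  rw [← hR, LinearIsometryEquiv.inner_map_map]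

/-- The Chapman–Kolmogorov equation. -/
lemma lintegral_stableKernel_mul_stableKernel (hd : 0 < d) (hα0 : 0 < α) (hα2 : α < 2)
    {s t : ℝ} (hs : 0 < s) (ht : 0 < t) (x y : EuclideanSpace ℝ (Fin d)) :
    ∫⁻ z, stableKernel d α s x z * stableKernel d α t z y = stableKernel d α (s + t) x y := by
  have hb : Integrable fun z => stableDensity d α s z * stableDensity d α t ((y - x) - z) :=
    (integrable_stableDensity hd hα0 hα2 hs).mul_bdd
      ((measurable_stableDensity d α t).comp (by fun_prop)).aestronglyMeasurable
      (ae_of_all _ fun z => abs_stableDensity_le hd hα0 ht _)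
  simp only [stableKernel]
  rw [← integral_stableDensity_mul_stableDensity_sub hd hα0 hα2 hs ht (y - x),
    ofReal_integral_eq_lintegral_ofReal hb (ae_of_all _ fun z => mul_nonneg
      (stableDensity_nonneg hd hα0 hα2 hs _) (stableDensity_nonneg hd hα0 hα2 ht _)),
    ← lintegral_add_right_eq_self _ x]
  refine lintegral_congr fun z => ?_
  rw [ENNReal.ofReal_mul (stableDensity_nonneg hd hα0 hα2 hs _)]
  rw [add_sub_cancel_right, show y - (z + x) = y - x - z by abel]

end Density

/-! ### Schrödinger perturbations -/

section Perturbation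

open Set

variable {X : Type*} [MeasurableSpace X] {m : Measure X} {p : ℝ → X → X → ℝ≥0∞} {q h : X → ℝ≥0∞}

lemma measurable_setLIntegral_Ioo {A : Type*} [MeasurableSpace A] {F : A → ℝ → ℝ≥0∞}
    (hF : Measurable (Function.uncurry F)) {τ : A → ℝ} (hτ : Measurable τ) :
    Measurable fun a => ∫⁻ s in Ioo 0 (τ a), F a s := by
  have hS : MeasurableSet {b : A × ℝ | 0 < b.2 ∧ b.2 < τ b.1} :=
    (measurableSet_lt measurable_const measurable_snd).inter
      (measurableSet_lt measurable_snd (hτ.comp measurable_fst))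
  have h := (hF.indicator hS).lintegral_prod_right' (ν := (volume : Measure ℝ))
  simp_rw [← lintegral_indicator measurableSet_Ioo]
  exact h

lemma measurable_perturbationTerm [SFinite m]
    (hp : Measurable fun a : ℝ × X × X => p a.1 a.2.1 a.2.2) (hq : Measurable q) (n : ℕ) :
    Measurable fun a : ℝ × X × X => perturbationTerm m p q n a.1 a.2.1 a.2.2 := by
  induction n with
  | zero => exact hp
  | succ n ih =>
    refine measurable_setLIntegral_Ioo (τ := fun a : ℝ × X × X => a.1) (F := fun a s =>
      ∫⁻ z, p s a.2.1 z * q z * perturbationTerm m p q n (a.1 - s) z a.2.2 ∂m) ?_ measurable_fst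
    refine Measurable.lintegral_prod_right' (f := fun b : ((ℝ × X × X) × ℝ) × X =>
      p b.1.2 b.1.1.2.1 b.2 * q b.2 * perturbationTerm m p q n (b.1.1.1 - b.1.2) b.2 b.1.1.2.2) ?_
    refine Measurable.mul (Measurable.mul ?_ (hq.comp measurable_snd)) ?_
    · exact hp.comp (g := fun a : ℝ × X × X => p a.1 a.2.1 a.2.2)
        (f := fun b : ((ℝ × X × X) × ℝ) × X => (b.1.2, b.1.1.2.1, b.2)) (by fun_prop)
    · exact ih.comp (g := fun a : ℝ × X × X => perturbationTerm m p q n a.1 a.2.1 a.2.2)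
        (f := fun b : ((ℝ × X × X) × ℝ) × X => (b.1.1.1 - b.1.2, b.2, b.1.1.2.2)) (by fun_prop)

lemma lintegral_perturbationTerm_succ_mul [SFinite m]
    (hp : Measurable fun a : ℝ × X × X => p a.1 a.2.1 a.2.2) (hq : Measurable q)
    (hh : Measurable h) (n : ℕ) (t : ℝ) (x : X) :
    ∫⁻ y, perturbationTerm m p q (n + 1) t x y * h y ∂m
      = ∫⁻ s in Ioo 0 t, ∫⁻ z, p s x z * q z *
          ∫⁻ y, perturbationTerm m p q n (t - s) z y * h y ∂m ∂m := by
  have hT := measurable_perturbationTerm (m := m) hp hq n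
  have hT' : Measurable fun b : (X × ℝ) × X => perturbationTerm m p q n (t - b.1.2) b.2 b.1.1 :=
    hT.comp (g := fun a : ℝ × X × X => perturbationTerm m p q n a.1 a.2.1 a.2.2)
      (f := fun b : (X × ℝ) × X => (t - b.1.2, b.2, b.1.1)) (by fun_prop)
  have hp' : Measurable fun b : (X × ℝ) × X => p b.1.2 x b.2 :=
    hp.comp (g := fun a : ℝ × X × X => p a.1 a.2.1 a.2.2)
      (f := fun b : (X × ℝ) × X => (b.1.2, x, b.2)) (by fun_prop)
  have hG : Measurable fun b : (X × ℝ) × X =>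
      p b.1.2 x b.2 * q b.2 * perturbationTerm m p q n (t - b.1.2) b.2 b.1.1 * h b.1.1 := by
    fun_prop
  have hG0 : Measurable fun b : (X × ℝ) × X =>
      p b.1.2 x b.2 * q b.2 * perturbationTerm m p q n (t - b.1.2) b.2 b.1.1 := by
    fun_prop
  have e1 : ∀ y, perturbationTerm m p q (n + 1) t x y * h y
      = ∫⁻ s in Ioo 0 t, ∫⁻ z, p s x z * q z * perturbationTerm m p q n (t - s) z y * h y ∂m := by
    intro y
    have h1 : Measurable fun s => ∫⁻ z, p s x z * q z * perturbationTerm m p q n (t - s) z y ∂m :=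
      hG0.lintegral_prod_right'.comp (measurable_prodMk_left (x := y))
    have h2 : ∀ s, Measurable fun z => p s x z * q z * perturbationTerm m p q n (t - s) z y :=
      fun s => hG0.comp (measurable_prodMk_left (x := (y, s)))
    simp only [perturbationTerm]
    rw [← lintegral_mul_const _ h1]
    exact lintegral_congr fun s => (lintegral_mul_const _ (h2 s)).symm
  simp_rw [e1]
  rw [lintegral_lintegral_swap (hG.lintegral_prod_right').aemeasurable]
  refine lintegral_congr fun s => ?_
  have h3 : Measurable (Function.uncurry fun y z =>
      p s x z * q z * perturbationTerm m p q n (t - s) z y * h y) :=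
    hG.comp (g := fun b : (X × ℝ) × X =>
      p b.1.2 x b.2 * q b.2 * perturbationTerm m p q n (t - b.1.2) b.2 b.1.1 * h b.1.1)
      (f := fun b : X × X => ((b.1, s), b.2)) (by fun_prop)
  rw [lintegral_lintegral_swap h3.aemeasurable]
  refine lintegral_congr fun z => ?_
  have hT2 : Measurable fun y => perturbationTerm m p q n (t - s) z y * h y :=
    (hT.comp (g := fun a : ℝ × X × X => perturbationTerm m p q n a.1 a.2.1 a.2.2)
      (f := fun y : X => (t - s, z, y)) (by fun_prop)).mul hh
  rw [← lintegral_const_mul _ hT2]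
  refine lintegral_congr fun y => ?_
  rw [mul_assoc]

/-- If `P_t h + ∫_0^t P_s (q h) ds ≤ h`, then `h` is supermedian for the Schrödinger perturbation:
by induction, every partial sum of the perturbation series maps `h` below `h`. -/
theorem lintegral_schrodingerPerturbation_mul_le [SFinite m]
    (hp : Measurable fun a : ℝ × X × X => p a.1 a.2.1 a.2.2) (hq : Measurable q)
    (hh : Measurable h)
    (H : ∀ t : ℝ, 0 < t → ∀ x, ∫⁻ y, p t x y * h y ∂m
      + ∫⁻ s in Ioo 0 t, ∫⁻ z, p s x z * (q z * h z) ∂m ≤ h x) {t : ℝ} (ht : 0 < t) (x : X) :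
    ∫⁻ y, schrodingerPerturbation m p q t x y * h y ∂m ≤ h x := by
  have hT := measurable_perturbationTerm (m := m) hp hq
  have hTy : ∀ n t x, Measurable fun y => perturbationTerm m p q n t x y * h y := fun n t x =>
    ((hT n).comp (g := fun a : ℝ × X × X => perturbationTerm m p q n a.1 a.2.1 a.2.2)
      (f := fun y : X => (t, x, y)) (by fun_prop)).mul hh
  have hI : ∀ n, Measurable fun b : ℝ × X =>
      ∫⁻ y, perturbationTerm m p q n b.1 b.2 y * h y ∂m := fun n =>
    (((hT n).comp (g := fun a : ℝ × X × X => perturbationTerm m p q n a.1 a.2.1 a.2.2)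
      (f := fun b : (ℝ × X) × X => (b.1.1, b.1.2, b.2)) (by fun_prop)).mul
      (hh.comp measurable_snd)).lintegral_prod_right'
  have hpart : ∀ N : ℕ, ∀ t : ℝ, 0 < t → ∀ x,
      ∑ n ∈ Finset.range N, ∫⁻ y, perturbationTerm m p q n t x y * h y ∂m ≤ h x := by
    intro N
    induction N with
    | zero => simp
    | succ N ih =>
      intro t ht x
      rw [Finset.sum_range_succ', add_comm]
      refine le_trans (add_le_add le_rfl ?_) (H t ht x)
      simp_rw [lintegral_perturbationTerm_succ_mul hp hq hh]
      have hm : ∀ n, Measurable fun b : ℝ × X => p b.1 x b.2 * q b.2 *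
          ∫⁻ y, perturbationTerm m p q n (t - b.1) b.2 y * h y ∂m := fun n =>
        ((hp.comp (g := fun a : ℝ × X × X => p a.1 a.2.1 a.2.2)
          (f := fun b : ℝ × X => (b.1, x, b.2)) (by fun_prop)).mul (hq.comp measurable_snd)).mul
          ((hI n).comp (g := fun b : ℝ × X => ∫⁻ y, perturbationTerm m p q n b.1 b.2 y * h y ∂m)
            (f := fun b : ℝ × X => (t - b.1, b.2)) (by fun_prop))
      rw [← lintegral_finsetSum _ fun n _ => (hm n).lintegral_prod_right']
      refine setLIntegral_mono' measurableSet_Ioo fun s hs => ?_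
      have hm' : ∀ n, Measurable fun z => p s x z * q z *
          ∫⁻ y, perturbationTerm m p q n (t - s) z y * h y ∂m := fun n =>
        (hm n).comp (measurable_prodMk_left (x := s))
      simp only
      rw [← lintegral_finsetSum _ fun n _ => hm' n]
      refine lintegral_mono fun z => ?_
      rw [← Finset.mul_sum, mul_assoc]
      gcongr
      exact ih (t - s) (sub_pos.2 hs.2) z
  simp_rw [schrodingerPerturbation, ← ENNReal.tsum_mul_right]
  rw [lintegral_tsum fun n => (hTy n t x).aemeasurable]
  exact ENNReal.tsum_le_of_sum_range_le fun N => hpart N t ht x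

end Perturbation

/-! ### Weighted potentials of the stable semigroup -/

section Potential

open Set

variable {d : ℕ} {α : ℝ}

lemma measurable_stableKernel_uncurry (d : ℕ) (α : ℝ) :
    Measurable fun a : ℝ × EuclideanSpace ℝ (Fin d) × EuclideanSpace ℝ (Fin d) =>
      stableKernel d α a.1 a.2.1 a.2.2 := by
  refine ENNReal.measurable_ofReal.comp ((measurable_stableDensity_uncurry d α).comp
    (g := fun p => stableDensity d α p.1 p.2)
    (f := fun a : ℝ × EuclideanSpace ℝ (Fin d) × EuclideanSpace ℝ (Fin d) =>
      (a.1, a.2.2 - a.2.1)) (by fun_prop))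

lemma stableKernel_zero_right (t : ℝ) (x : EuclideanSpace ℝ (Fin d)) :
    stableKernel d α t x 0 = ENNReal.ofReal (stableDensity d α t x) := by
  rw [stableKernel, zero_sub, stableDensity_neg]

lemma measurable_stableKernel_zero_right (d : ℕ) (α : ℝ) :
    Measurable fun a : ℝ × EuclideanSpace ℝ (Fin d) => stableKernel d α a.1 a.2 0 :=
  (measurable_stableKernel_uncurry d α).comp
    (g := fun a : ℝ × EuclideanSpace ℝ (Fin d) × EuclideanSpace ℝ (Fin d) =>
      stableKernel d α a.1 a.2.1 a.2.2)
    (f := fun a : ℝ × EuclideanSpace ℝ (Fin d) => (a.1, a.2, 0)) (by fun_prop)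

/-- The weight `s ↦ s ^ β` on `(0, ∞)`, extended by zero to `ℝ`. -/
noncomputable def powerWeight (β s : ℝ) : ℝ≥0∞ :=
  (Ioi (0 : ℝ)).indicator (fun s => ENNReal.ofReal (s ^ β)) s

lemma measurable_powerWeight (β : ℝ) : Measurable (powerWeight β) :=
  (by fun_prop : Measurable fun s : ℝ => ENNReal.ofReal (s ^ β)).indicator measurableSet_Ioi

lemma powerWeight_of_pos (β : ℝ) {s : ℝ} (hs : 0 < s) :
    powerWeight β s = ENNReal.ofReal (s ^ β) :=
  indicator_of_mem (mem_Ioi.2 hs) _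

lemma powerWeight_of_nonpos (β : ℝ) {s : ℝ} (hs : s ≤ 0) : powerWeight β s = 0 :=
  indicator_of_notMem (notMem_Ioi.2 hs) _

lemma monotone_powerWeight {β : ℝ} (hβ : 0 ≤ β) : Monotone (powerWeight β) := by
  intro s t hst
  rcases le_or_gt s 0 with hs | hs
  · rw [powerWeight_of_nonpos β hs]
    exact zero_le
  · rw [powerWeight_of_pos β hs, powerWeight_of_pos β (hs.trans_le hst)]
    exact ENNReal.ofReal_le_ofReal (Real.rpow_le_rpow hs.le hst hβ)

/-- The time-weighted potential `∫_0^∞ s ^ β p_s(x, 0) ds` of the stable semigroup. -/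
noncomputable def weightedPotential (d : ℕ) (α β : ℝ) (x : EuclideanSpace ℝ (Fin d)) : ℝ≥0∞ :=
  ∫⁻ s, powerWeight β s * stableKernel d α s x 0

lemma weightedPotential_eq_setLIntegral (β : ℝ) (x : EuclideanSpace ℝ (Fin d)) :
    weightedPotential d α β x
      = ∫⁻ s in Ioi 0, ENNReal.ofReal (s ^ β) * ENNReal.ofReal (stableDensity d α s x) := by
  rw [weightedPotential, ← lintegral_indicator measurableSet_Ioi]
  refine lintegral_congr fun s => ?_
  rw [stableKernel_zero_right, powerWeight]
  simp only [indicator, ite_mul, zero_mul]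

/-- Applying the semigroup to the weighted potential shifts the weight in time. -/
lemma lintegral_stableKernel_mul_weightedPotential (hd : 0 < d) (hα0 : 0 < α) (hα2 : α < 2)
    (β : ℝ) {t : ℝ} (ht : 0 < t) (x : EuclideanSpace ℝ (Fin d)) :
    ∫⁻ y, stableKernel d α t x y * weightedPotential d α β y
      = ∫⁻ s, powerWeight β (s - t) * stableKernel d α s x 0 := by
  have hk : Measurable fun y => stableKernel d α t x y :=
    (measurable_stableKernel_uncurry d α).comp
      (g := fun a : ℝ × EuclideanSpace ℝ (Fin d) × EuclideanSpace ℝ (Fin d) =>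
        stableKernel d α a.1 a.2.1 a.2.2) (f := fun y => (t, x, y)) (by fun_prop)
  have h0 := measurable_stableKernel_zero_right d α
  have hw := measurable_powerWeight β
  have hs : ∀ y, Measurable fun s => powerWeight β s * stableKernel d α s y 0 := fun y =>
    hw.mul (h0.comp (g := fun a : ℝ × EuclideanSpace ℝ (Fin d) => stableKernel d α a.1 a.2 0)
      (f := fun s => (s, y)) (by fun_prop))
  have hy : ∀ s, Measurable fun y => stableKernel d α s y 0 := fun s =>
    h0.comp (g := fun a : ℝ × EuclideanSpace ℝ (Fin d) => stableKernel d α a.1 a.2 0)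
      (f := fun y => (s, y)) (by fun_prop)
  have hky : ∀ s, Measurable fun y => stableKernel d α t x y * stableKernel d α s y 0 :=
    fun s => hk.mul (hy s)
  have hys : Measurable (Function.uncurry fun (y : EuclideanSpace ℝ (Fin d)) (s : ℝ) =>
      stableKernel d α t x y * (powerWeight β s * stableKernel d α s y 0)) :=
    (hk.comp (g := fun y => stableKernel d α t x y) measurable_fst).mul
      ((hw.comp measurable_snd).mul (h0.comp
      (g := fun a : ℝ × EuclideanSpace ℝ (Fin d) => stableKernel d α a.1 a.2 0)
      (f := Prod.swap) measurable_swap))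
  calc ∫⁻ y, stableKernel d α t x y * weightedPotential d α β y
      = ∫⁻ y, ∫⁻ s, stableKernel d α t x y * (powerWeight β s * stableKernel d α s y 0) :=
        lintegral_congr fun y => (lintegral_const_mul _ (hs y)).symm
    _ = ∫⁻ s, ∫⁻ y, stableKernel d α t x y * (powerWeight β s * stableKernel d α s y 0) :=
        lintegral_lintegral_swap hys.aemeasurable
    _ = ∫⁻ s, powerWeight β s * stableKernel d α (s + t) x 0 := by
        refine lintegral_congr fun s => ?_
        rcases le_or_gt s 0 with hs0 | hs0
        · simp [powerWeight_of_nonpos β hs0]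
        · rw [add_comm s t, ← lintegral_stableKernel_mul_stableKernel hd hα0 hα2 ht hs0,
            ← lintegral_const_mul _ (hky s)]
          exact lintegral_congr fun y => mul_left_comm _ _ _
    _ = ∫⁻ s, powerWeight β (s - t) * stableKernel d α s x 0 := by
        rw [← lintegral_add_right_eq_self
          (fun s => powerWeight β (s - t) * stableKernel d α s x 0) t]
        simp

lemma lintegral_stableKernel_mul_weightedPotential_le (hd : 0 < d) (hα0 : 0 < α) (hα2 : α < 2)
    {β : ℝ} (hβ : 0 ≤ β) {t : ℝ} (ht : 0 < t) (x : EuclideanSpace ℝ (Fin d)) :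
    ∫⁻ y, stableKernel d α t x y * weightedPotential d α β y ≤ weightedPotential d α β x := by
  rw [lintegral_stableKernel_mul_weightedPotential hd hα0 hα2 β ht]
  refine lintegral_mono fun s => ?_
  simp only
  gcongr
  exact monotone_powerWeight hβ (by linarith)

/-- The fundamental theorem of calculus for the weight: `∫_0^t β (v - s)_+ ^ (β - 1) ds` is the
increment of `(·)_+ ^ β` over `[v - t, v]`. -/
lemma powerWeight_sub_add_lintegral {β : ℝ} (hβ : 0 < β) {t : ℝ} (ht : 0 < t) (v : ℝ) :
    powerWeight β (v - t) + ∫⁻ s in Ioo 0 t, ENNReal.ofReal β * powerWeight (β - 1) (v - s)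
      = powerWeight β v := by
  rcases le_or_gt v 0 with hv | hv
  · rw [powerWeight_of_nonpos β hv, powerWeight_of_nonpos β (by linarith), zero_add,
      setLIntegral_congr_fun (g := 0) measurableSet_Ioo fun s hs => ?_]
    · simp
    · simp [powerWeight_of_nonpos (β - 1) (show v - s ≤ 0 by linarith [hs.1])]
  -- after `u = v - s` only `u > 0` counts, so that `u` ranges over `(max (v - t) 0, v)`
  set a := max (v - t) 0 with ha
  have ha0 : 0 ≤ a := le_max_right _ _
  have hav : a ≤ v := max_le (by linarith) hv.le
  have h1 : ∫⁻ s in Ioo 0 t, ENNReal.ofReal β * powerWeight (β - 1) (v - s)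
      = ∫⁻ u in Ioo a v, ENNReal.ofReal (β * u ^ (β - 1)) := by
    rw [← lintegral_indicator measurableSet_Ioo, ← lintegral_indicator measurableSet_Ioo,
      ← lintegral_sub_left_eq_self _ v]
    refine lintegral_congr fun u => ?_
    by_cases hu : u ∈ Ioo a v
    · have hu0 : 0 < u := ha0.trans_lt hu.1
      have hut : v - t < u := (le_max_left _ _).trans_lt hu.1
      rw [indicator_of_mem hu, indicator_of_mem
          (show v - u ∈ Ioo 0 t from ⟨by linarith [hu.2], by linarith⟩),
        sub_sub_cancel, powerWeight_of_pos _ hu0, ENNReal.ofReal_mul hβ.le]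
    · rw [indicator_of_notMem hu]
      by_cases hu2 : v - u ∈ Ioo 0 t
      · rw [indicator_of_mem hu2, sub_sub_cancel, powerWeight_of_nonpos, mul_zero]
        by_contra! hu0
        exact hu ⟨max_lt (by linarith [hu2.2]) hu0, by linarith [hu2.1]⟩
      · rw [indicator_of_notMem hu2]
  have hint : IntervalIntegrable (fun u : ℝ => β * u ^ (β - 1)) volume a v :=
    (intervalIntegral.intervalIntegrable_rpow' (by linarith)).const_mul _
  rw [intervalIntegrable_iff_integrableOn_Ioc_of_le hav] at hint
  have h2 : ∫⁻ u in Ioo a v, ENNReal.ofReal (β * u ^ (β - 1))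
      = ENNReal.ofReal (v ^ β - a ^ β) := by
    rw [setLIntegral_congr Ioo_ae_eq_Ioc, ← ofReal_integral_eq_lintegral_ofReal hint
      ((ae_restrict_mem measurableSet_Ioc).mono fun u hu => ?_),
      ← intervalIntegral.integral_of_le hav, intervalIntegral.integral_const_mul,
      integral_rpow (Or.inl (by linarith)), sub_add_cancel, mul_div_cancel₀ _ hβ.ne']
    have hu0 : 0 < u := ha0.trans_lt hu.1
    simp only [Pi.zero_apply]
    positivity
  have h3 : powerWeight β (v - t) = ENNReal.ofReal (a ^ β) := by
    rcases le_or_gt (v - t) 0 with h | h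
    · rw [powerWeight_of_nonpos β h, ha, max_eq_right h, Real.zero_rpow hβ.ne', ENNReal.ofReal_zero]
    · rw [powerWeight_of_pos β h, ha, max_eq_left h.le]
  have h4 : a ^ β ≤ v ^ β := Real.rpow_le_rpow ha0 hav hβ.le
  rw [h1, h2, h3, powerWeight_of_pos β hv, ← ENNReal.ofReal_add (by positivity) (by linarith),
    add_sub_cancel]

/-- The Duhamel identity behind the Hardy potential: perturbing with `β h_{β-1}` exactly restores
what the semigroup removes from `h_β`. -/
lemma lintegral_weightedPotential_add_lintegral (hd : 0 < d) (hα0 : 0 < α) (hα2 : α < 2)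
    {β : ℝ} (hβ : 0 < β) {t : ℝ} (ht : 0 < t) (x : EuclideanSpace ℝ (Fin d)) :
    (∫⁻ y, stableKernel d α t x y * weightedPotential d α β y)
      + ∫⁻ s in Ioo 0 t, ENNReal.ofReal β *
        ∫⁻ z, stableKernel d α s x z * weightedPotential d α (β - 1) z
      = weightedPotential d α β x := by
  have hw := measurable_powerWeight β
  have hw1 := measurable_powerWeight (β - 1)
  have h0 : Measurable fun s => stableKernel d α s x 0 :=
    (measurable_stableKernel_zero_right d α).comp
      (g := fun a : ℝ × EuclideanSpace ℝ (Fin d) => stableKernel d α a.1 a.2 0)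
      (f := fun s => (s, x)) (by fun_prop)
  have hm : Measurable (Function.uncurry fun s v : ℝ =>
      ENNReal.ofReal β * (powerWeight (β - 1) (v - s) * stableKernel d α v x 0)) :=
    ((hw1.comp (by fun_prop)).mul (h0.comp measurable_snd)).const_mul _
  have hwt : Measurable fun s => powerWeight β (s - t) * stableKernel d α s x 0 :=
    (hw.comp (by fun_prop)).mul h0
  have hmv : ∀ v, Measurable fun s => ENNReal.ofReal β * powerWeight (β - 1) (v - s) := fun v =>
    (hw1.comp (by fun_prop)).const_mul _
  have e : ∫⁻ s in Ioo 0 t, ENNReal.ofReal β *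
        ∫⁻ z, stableKernel d α s x z * weightedPotential d α (β - 1) z
      = ∫⁻ v, (∫⁻ s in Ioo 0 t, ENNReal.ofReal β * powerWeight (β - 1) (v - s)) *
          stableKernel d α v x 0 := by
    calc _ = ∫⁻ s in Ioo 0 t, ∫⁻ v,
          ENNReal.ofReal β * (powerWeight (β - 1) (v - s) * stableKernel d α v x 0) := by
          refine setLIntegral_congr_fun measurableSet_Ioo fun s hs => ?_
          rw [lintegral_stableKernel_mul_weightedPotential hd hα0 hα2 (β - 1) hs.1,
            ← lintegral_const_mul]
          exact (hw1.comp (by fun_prop)).mul h0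
      _ = ∫⁻ v, ∫⁻ s in Ioo 0 t,
          ENNReal.ofReal β * (powerWeight (β - 1) (v - s) * stableKernel d α v x 0) :=
          lintegral_lintegral_swap hm.aemeasurable
      _ = _ := by
          refine lintegral_congr fun v => ?_
          rw [← lintegral_mul_const _ (hmv v)]
          exact lintegral_congr fun s => (mul_assoc _ _ _).symm
  rw [lintegral_stableKernel_mul_weightedPotential hd hα0 hα2 β ht, e,
    ← lintegral_add_left hwt, weightedPotential]
  refine lintegral_congr fun v => ?_
  rw [← add_mul, powerWeight_sub_add_lintegral hβ ht]

lemma setLIntegral_Ioi_comp_mul_left (g : ℝ → ℝ≥0∞) {b : ℝ} (hb : 0 < b) :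
    ∫⁻ s in Ioi 0, g s = ENNReal.ofReal b * ∫⁻ u in Ioi 0, g (b * u) := by
  have h := lintegral_image_eq_lintegral_abs_deriv_mul (s := Ioi (0 : ℝ)) (f := fun u => b * u)
    (f' := fun _ => b) measurableSet_Ioi
    (fun u _ => by simpa using ((hasDerivAt_id u).const_mul b).hasDerivWithinAt)
    (mul_right_injective₀ hb.ne').injOn g
  rw [image_const_mul_Ioi_zero hb, abs_of_pos hb] at h
  rw [h, lintegral_const_mul' _ _ ENNReal.ofReal_ne_top]

/-- Stable scaling makes the weighted potential homogeneous of degree `α (β + 1) - d`. -/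
lemma weightedPotential_smul (β : ℝ) {c : ℝ} (hc : 0 < c)
    (x : EuclideanSpace ℝ (Fin d)) :
    weightedPotential d α β (c • x)
      = ENNReal.ofReal (c ^ (α * (β + 1) - d)) * weightedPotential d α β x := by
  have hcα : 0 < c ^ α := by positivity
  rw [weightedPotential_eq_setLIntegral, weightedPotential_eq_setLIntegral,
    setLIntegral_Ioi_comp_mul_left _ hcα, ← lintegral_const_mul' _ _ ENNReal.ofReal_ne_top,
    ← lintegral_const_mul' _ _ ENNReal.ofReal_ne_top]
  refine setLIntegral_congr_fun measurableSet_Ioi fun s hs => ?_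
  have hs0 : 0 < s := hs
  rw [stableDensity_smul _ hc, Real.mul_rpow hcα.le hs0.le, ENNReal.ofReal_mul (by positivity),
    ENNReal.ofReal_mul (by positivity), ← Real.rpow_mul hc.le]
  have e : c ^ (α * (β + 1) - d) = c ^ α * c ^ (α * β) * (c ^ d)⁻¹ := by
    rw [← Real.rpow_add hc, ← Real.rpow_natCast c d, ← Real.rpow_neg hc.le, ← Real.rpow_add hc]
    ring_nf
  rw [e, ENNReal.ofReal_mul (by positivity), ENNReal.ofReal_mul (by positivity)]
  ring

lemma weightedPotential_eq_of_norm_eq (β : ℝ) {x y : EuclideanSpace ℝ (Fin d)}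
    (h : ‖x‖ = ‖y‖) : weightedPotential d α β x = weightedPotential d α β y := by
  simp only [weightedPotential, stableKernel_zero_right]
  simp_rw [stableDensity_eq_of_norm_eq _ h]

lemma exists_weightedPotential_eq (hd : 0 < d) (α β : ℝ) :
    ∃ K : ℝ≥0∞, ∀ x : EuclideanSpace ℝ (Fin d), x ≠ 0 →
      weightedPotential d α β x = K * ENNReal.ofReal (‖x‖ ^ (α * (β + 1) - d)) := by
  set e : EuclideanSpace ℝ (Fin d) := EuclideanSpace.single ⟨0, hd⟩ 1 with he
  have hen : ‖e‖ = 1 := by simp [he]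
  refine ⟨weightedPotential d α β e, fun x hx => ?_⟩
  have hn : 0 < ‖x‖ := norm_pos_iff.2 hx
  rw [weightedPotential_eq_of_norm_eq β (show ‖x‖ = ‖‖x‖ • e‖ by rw [norm_smul, hen]; simp),
    weightedPotential_smul β hn, mul_comm]

lemma lintegral_rpow_mul_exp_neg {β l : ℝ} (hβ : -1 < β) (hl : 0 < l) :
    ∫⁻ s in Ioi 0, ENNReal.ofReal (s ^ β * Real.exp (-(l * s)))
      = ENNReal.ofReal (Real.Gamma (β + 1) * l ^ (-(β + 1))) := by
  have h := Real.integral_rpow_mul_exp_neg_mul_Ioi (show 0 < β + 1 by linarith) hl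
  simp only [add_sub_cancel_right] at h
  have hi : IntegrableOn (fun s : ℝ => s ^ β * Real.exp (-(l * s))) (Ioi 0) := by
    have := integrableOn_rpow_mul_exp_neg_mul_rpow hβ one_pos hl
    simpa using this
  rw [← ofReal_integral_eq_lintegral_ofReal hi
    ((ae_restrict_mem measurableSet_Ioi).mono fun s (hs : 0 < s) => ?_), h, mul_comm,
    one_div, Real.inv_rpow hl.le, ← Real.rpow_neg hl.le]
  simp only [Pi.zero_apply]
  positivity

/-- The total mass of the unit sphere of `ℝ^d`, the constant of integration in polar coordinates. -/
noncomputable def sphereArea (d : ℕ) : ℝ :=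
  d * (volume : Measure (EuclideanSpace ℝ (Fin d))).real (Metric.ball 0 1)

lemma sphereArea_pos (hd : 0 < d) : 0 < sphereArea d := by
  refine mul_pos (Nat.cast_pos.2 hd) (ENNReal.toReal_pos ?_ measure_ball_lt_top.ne)
  exact (Metric.measure_ball_pos volume _ one_pos).ne'

lemma lintegral_exp_mul_norm_rpow (hd : 0 < d) {c : ℝ} (hc : 0 < d + c) :
    ∫⁻ x : EuclideanSpace ℝ (Fin d),
      ENNReal.ofReal (Real.exp (-(1 / 2) * ‖x‖ ^ 2)) * ENNReal.ofReal (‖x‖ ^ c)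
      = ENNReal.ofReal (sphereArea d * (2 ^ ((d + c) / 2) * (1 / 2) *
          Real.Gamma ((d + c) / 2))) := by
  have : Nonempty (Fin d) := ⟨⟨0, hd⟩⟩
  set f : ℝ → ℝ := fun ρ => Real.exp (-(1 / 2) * ρ ^ 2) * ρ ^ c with hf
  have hcast : ((d - 1 : ℕ) : ℝ) = d - 1 := by
    rw [Nat.cast_sub (by omega), Nat.cast_one]
  have e : ∀ ρ ∈ Ioi (0 : ℝ), ρ ^ ((d : ℝ) - 1 + c) * Real.exp (-(1 / 2) * ρ ^ (2 : ℝ))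
      = ρ ^ (d - 1) • f ρ := by
    intro ρ hρ
    rw [Real.rpow_add hρ, ← hcast, Real.rpow_natCast, Real.rpow_two, smul_eq_mul]
    ring
  have hi : Integrable fun x : EuclideanSpace ℝ (Fin d) => f ‖x‖ := by
    rw [integrable_fun_norm_addHaar volume (f := f), finrank_euclideanSpace, Fintype.card_fin]
    exact (integrableOn_rpow_mul_exp_neg_mul_rpow (by linarith) two_pos (by norm_num)).congr_fun e
      measurableSet_Ioi
  simp_rw [← ENNReal.ofReal_mul (Real.exp_pos _).le]
  rw [← ofReal_integral_eq_lintegral_ofReal hi (ae_of_all _ fun x => by positivity),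
    integral_fun_norm_addHaar volume f, finrank_euclideanSpace, Fintype.card_fin,
    ← setIntegral_congr_fun measurableSet_Ioi e,
    integral_rpow_mul_exp_neg_mul_rpow two_pos (by linarith) (by norm_num)]
  congr 1
  rw [sphereArea, show (d : ℝ) - 1 + c + 1 = d + c by ring, one_div, Real.inv_rpow (by norm_num),
    ← Real.rpow_neg (by norm_num), nsmul_eq_mul, smul_eq_mul, neg_div, neg_neg]
  ring

/-- The constant `K` in `∫_0^∞ s ^ β p_s(x, 0) ds = K |x| ^ (α (β + 1) - d)`. -/
noncomputable def potentialConstant (d : ℕ) (α β : ℝ) : ℝ :=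
  ((2 * Real.pi) ^ d)⁻¹ * (2 * Real.pi) ^ (d / 2 : ℝ) * Real.Gamma (β + 1) *
    (2 ^ ((d - α * (β + 1)) / 2) * Real.Gamma ((d - α * (β + 1)) / 2)) /
    (2 ^ (α * (β + 1) / 2) * Real.Gamma (α * (β + 1) / 2))

lemma potentialConstant_pos (hα0 : 0 < α) {β : ℝ} (hβ : -1 < β) (hβd : α * (β + 1) < d) :
    0 < potentialConstant d α β := by
  have h1 : 0 < β + 1 := by linarith
  have h2 := Real.Gamma_pos_of_pos h1
  have h3 := Real.Gamma_pos_of_pos (show 0 < (d - α * (β + 1)) / 2 by linarith)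
  have h4 := Real.Gamma_pos_of_pos (show 0 < α * (β + 1) / 2 by positivity)
  unfold potentialConstant
  positivity

/-- By the Parseval formula, the Gaussian average of the weighted potential is that of its Fourier
symbol `∫_0^∞ s ^ β exp (-s |ξ| ^ α) ds = Γ (β + 1) |ξ| ^ (-α (β + 1))`. -/
lemma lintegral_exp_mul_weightedPotential (hd : 0 < d) (hα0 : 0 < α) (hα2 : α < 2)
    {β : ℝ} (hβ : -1 < β) :
    ∫⁻ x : EuclideanSpace ℝ (Fin d), ENNReal.ofReal (Real.exp (-(1 / 2) * ‖x‖ ^ 2)) *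
        weightedPotential d α β x
      = ENNReal.ofReal (((2 * Real.pi) ^ d)⁻¹ * (2 * Real.pi) ^ (d / 2 : ℝ)) *
        (ENNReal.ofReal (Real.Gamma (β + 1)) * ∫⁻ ξ : EuclideanSpace ℝ (Fin d),
          ENNReal.ofReal (Real.exp (-(1 / 2) * ‖ξ‖ ^ 2)) *
            ENNReal.ofReal (‖ξ‖ ^ (-(α * (β + 1))))) := by
  have : Nonempty (Fin d) := ⟨⟨0, hd⟩⟩
  have hp := measurable_stableDensity_uncurry d α
  have hm : Measurable (Function.uncurry fun (x : EuclideanSpace ℝ (Fin d)) (s : ℝ) =>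
      ENNReal.ofReal (Real.exp (-(1 / 2) * ‖x‖ ^ 2)) *
        (ENNReal.ofReal (s ^ β) * ENNReal.ofReal (stableDensity d α s x))) := by
    have hps : Measurable fun a : EuclideanSpace ℝ (Fin d) × ℝ =>
        ENNReal.ofReal (stableDensity d α a.2 a.1) := by
      have h := hp.ennreal_ofReal.comp measurable_swap
      simp only [Function.comp_def, Prod.fst_swap, Prod.snd_swap] at h
      exact h
    have h1 : Measurable fun a : EuclideanSpace ℝ (Fin d) × ℝ =>
        ENNReal.ofReal (Real.exp (-(1 / 2) * ‖a.1‖ ^ 2)) := by fun_prop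
    have h2 : Measurable fun a : EuclideanSpace ℝ (Fin d) × ℝ => ENNReal.ofReal (a.2 ^ β) := by
      fun_prop
    exact h1.mul (h2.mul hps)
  have hm2 : Measurable (Function.uncurry fun (s : ℝ) (ξ : EuclideanSpace ℝ (Fin d)) =>
      ENNReal.ofReal (Real.exp (-(1 / 2) * ‖ξ‖ ^ 2)) *
        ENNReal.ofReal (s ^ β * Real.exp (-(‖ξ‖ ^ α * s)))) := by
    unfold Function.uncurry
    fun_prop
  set c := ENNReal.ofReal (((2 * Real.pi) ^ d)⁻¹ * (2 * Real.pi) ^ (d / 2 : ℝ)) with hc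
  calc _ = ∫⁻ x : EuclideanSpace ℝ (Fin d), ∫⁻ s in Ioi 0,
          ENNReal.ofReal (Real.exp (-(1 / 2) * ‖x‖ ^ 2)) *
          (ENNReal.ofReal (s ^ β) * ENNReal.ofReal (stableDensity d α s x)) := by
        refine lintegral_congr fun x => ?_
        rw [weightedPotential_eq_setLIntegral, lintegral_const_mul' _ _ ENNReal.ofReal_ne_top]
    _ = ∫⁻ s in Ioi 0, ∫⁻ x : EuclideanSpace ℝ (Fin d),
          ENNReal.ofReal (Real.exp (-(1 / 2) * ‖x‖ ^ 2)) *
          (ENNReal.ofReal (s ^ β) * ENNReal.ofReal (stableDensity d α s x)) :=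
        lintegral_lintegral_swap hm.aemeasurable
    _ = ∫⁻ s in Ioi 0, ∫⁻ ξ : EuclideanSpace ℝ (Fin d), c *
          (ENNReal.ofReal (Real.exp (-(1 / 2) * ‖ξ‖ ^ 2)) *
          ENNReal.ofReal (s ^ β * Real.exp (-(‖ξ‖ ^ α * s)))) := by
        refine setLIntegral_congr_fun measurableSet_Ioi fun s hs => ?_
        have hs0 : 0 < s := hs
        simp_rw [mul_left_comm _ (ENNReal.ofReal (s ^ β))]
        rw [lintegral_const_mul' _ _ ENNReal.ofReal_ne_top,
          lintegral_exp_neg_mul_sq_norm_mul_stableDensity hd hα0 hα2 hs0 one_half_pos,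
          show Real.pi / (1 / 2) = 2 * Real.pi by ring, ← hc, mul_left_comm,
          lintegral_const_mul' _ _ ENNReal.ofReal_ne_top,
          ← lintegral_const_mul' _ _ ENNReal.ofReal_ne_top]
        congr 1
        refine lintegral_congr fun ξ => ?_
        rw [← ENNReal.ofReal_mul (by positivity), ← ENNReal.ofReal_mul (by positivity)]
        ring_nf
    _ = ∫⁻ ξ : EuclideanSpace ℝ (Fin d), ∫⁻ s in Ioi 0, c *
          (ENNReal.ofReal (Real.exp (-(1 / 2) * ‖ξ‖ ^ 2)) *
          ENNReal.ofReal (s ^ β * Real.exp (-(‖ξ‖ ^ α * s)))) :=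
        lintegral_lintegral_swap (hm2.const_mul c).aemeasurable
    _ = ∫⁻ ξ : EuclideanSpace ℝ (Fin d), c * (ENNReal.ofReal (Real.Gamma (β + 1)) *
          (ENNReal.ofReal (Real.exp (-(1 / 2) * ‖ξ‖ ^ 2)) *
            ENNReal.ofReal (‖ξ‖ ^ (-(α * (β + 1)))))) := by
        refine lintegral_congr_ae ((Measure.ae_ne volume 0).mono fun ξ hξ => ?_)
        have hn : 0 < ‖ξ‖ := norm_pos_iff.2 hξ
        have hG := Real.Gamma_pos_of_pos (show 0 < β + 1 by linarith)
        simp only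
        rw [lintegral_const_mul' _ _ ENNReal.ofReal_ne_top,
          lintegral_const_mul' _ _ ENNReal.ofReal_ne_top,
          lintegral_rpow_mul_exp_neg hβ (by positivity), ENNReal.ofReal_mul hG.le,
          ← Real.rpow_mul hn.le, mul_neg, mul_left_comm (ENNReal.ofReal (Real.exp _))]
    _ = _ := by
        rw [lintegral_const_mul' _ _ ENNReal.ofReal_ne_top,
          lintegral_const_mul' _ _ ENNReal.ofReal_ne_top]

/-- The weighted potential is an explicit multiple of a Riesz kernel. Homogeneity and rotation
invariance give the shape, and integrating against a Gaussian identifies the constant. -/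
theorem weightedPotential_eq (hd : 0 < d) (hα0 : 0 < α) (hα2 : α < 2) {β : ℝ} (hβ : -1 < β)
    (hβd : α * (β + 1) < d) {x : EuclideanSpace ℝ (Fin d)} (hx : x ≠ 0) :
    weightedPotential d α β x
      = ENNReal.ofReal (potentialConstant d α β) * ‖x‖ₑ ^ (-(d - α * (β + 1))) := by
  have : Nonempty (Fin d) := ⟨⟨0, hd⟩⟩
  obtain ⟨K, hK⟩ := exists_weightedPotential_eq hd α β
  have hσ : 0 < α * (β + 1) := mul_pos hα0 (by linarith)
  have h := lintegral_exp_mul_weightedPotential hd hα0 hα2 hβ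
  have h1 : ∫⁻ x : EuclideanSpace ℝ (Fin d), ENNReal.ofReal (Real.exp (-(1 / 2) * ‖x‖ ^ 2)) *
        weightedPotential d α β x
      = K * ENNReal.ofReal (sphereArea d * (2 ^ (α * (β + 1) / 2) * (1 / 2) *
          Real.Gamma (α * (β + 1) / 2))) := by
    have h2 := lintegral_exp_mul_norm_rpow hd (c := α * (β + 1) - d) (by linarith)
    rw [add_sub_cancel] at h2
    rw [← h2, ← lintegral_const_mul _ (by fun_prop)]
    refine lintegral_congr_ae ((Measure.ae_ne volume 0).mono fun y hy => ?_)
    simp only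
    rw [hK y hy, mul_left_comm]
  have h3 := lintegral_exp_mul_norm_rpow hd (c := -(α * (β + 1))) (by linarith)
  rw [← sub_eq_add_neg] at h3
  rw [h1, h3] at h
  have hS := sphereArea_pos hd
  have hG1 := Real.Gamma_pos_of_pos (show 0 < β + 1 by linarith)
  have hG2 := Real.Gamma_pos_of_pos (show 0 < (d - α * (β + 1)) / 2 by linarith)
  have hG3 := Real.Gamma_pos_of_pos (show 0 < α * (β + 1) / 2 by positivity)
  have hKc : K = ENNReal.ofReal (potentialConstant d α β) := by
    have hne : ENNReal.ofReal (sphereArea d * (2 ^ (α * (β + 1) / 2) * (1 / 2) *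
          Real.Gamma (α * (β + 1) / 2))) ≠ 0 := by
      rw [Ne, ENNReal.ofReal_eq_zero, not_le]
      positivity
    refine (ENNReal.mul_left_inj hne ENNReal.ofReal_ne_top).1 (h.trans ?_)
    rw [← ENNReal.ofReal_mul hG1.le, ← ENNReal.ofReal_mul (by positivity),
      ← ENNReal.ofReal_mul (potentialConstant_pos hα0 hβ hβd).le, potentialConstant]
    congr 1
    generalize α * (β + 1) = σ at hG2 hG3
    field_simp
  rw [hK x hx, hKc, ← ofReal_norm, ENNReal.ofReal_rpow_of_pos (norm_pos_iff.2 hx), neg_sub]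

/-- The Hardy coefficient is `β K_{β-1} / K_β`. -/
lemma mul_potentialConstant_sub_one (hα0 : 0 < α) {β : ℝ} (hβ : 0 < β)
    (hβd : α * (β + 1) < d) :
    β * potentialConstant d α (β - 1) = hardyCoefficient d α β * potentialConstant d α β := by
  have hG2 := Real.Gamma_pos_of_pos (show 0 < (d - α * (β + 1)) / 2 by linarith)
  have hG3 := Real.Gamma_pos_of_pos (show 0 < α * (β + 1) / 2 by positivity)
  have hG4 := Real.Gamma_pos_of_pos (show 0 < α * β / 2 by positivity)
  have hG := Real.Gamma_add_one hβ.ne'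
  have e1 : (2 : ℝ) ^ ((d - α * β) / 2) = 2 ^ ((d - α * (β + 1)) / 2) * 2 ^ (α / 2) := by
    rw [← Real.rpow_add two_pos]
    ring_nf
  have e2 : (2 : ℝ) ^ (α * (β + 1) / 2) = 2 ^ (α * β / 2) * 2 ^ (α / 2) := by
    rw [← Real.rpow_add two_pos]
    ring_nf
  have e3 : (4 : ℝ) ^ (α / 2) = 2 ^ (α / 2) * 2 ^ (α / 2) := by
    rw [← Real.mul_rpow two_pos.le two_pos.le]
    norm_num
  rw [potentialConstant, potentialConstant, hardyCoefficient, sub_add_cancel, hG, e1, e2, e3,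
    ← sub_div, ← sub_div]
  field_simp

end Potential

/-! ### Supermedian powers -/

theorem mainTheorem8 (d : ℕ) (α : ℝ) (hα0 : 0 < α) (hα2 : α < 2) :
    (∀ r : ℝ, 0 ≤ r → r ≤ (d : ℝ) - α →
      ∀ (x : EuclideanSpace ℝ (Fin d)) (t : ℝ), 0 < t →
        (∫⁻ y : EuclideanSpace ℝ (Fin d), stableKernel d α t x y * ‖y‖ₑ ^ (-r)) ≤ ‖x‖ₑ ^ (-r)) ∧
    (∀ r : ℝ, 0 < r → r < (d : ℝ) - α →
      ∀ (β : ℝ), β = ((d : ℝ) - α - r) / α →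
      ∀ (x : EuclideanSpace ℝ (Fin d)) (t : ℝ), 0 < t →
        (∫⁻ y : EuclideanSpace ℝ (Fin d),
          schrodingerPerturbation volume (stableKernel d α) (hardyPotential d α β) t x y
            * ‖y‖ₑ ^ (-r)) ≤ ‖x‖ₑ ^ (-r)) := by
  have hzero : ∀ r : ℝ, 0 < r → ‖(0 : EuclideanSpace ℝ (Fin d))‖ₑ ^ (-r) = ∞ := fun r hr => by
    rw [enorm_zero, ENNReal.zero_rpow_of_neg (neg_lt_zero.2 hr)]
  have hd_of : ∀ r : ℝ, 0 ≤ r → r ≤ (d : ℝ) - α → 0 < d := fun r hr0 hr =>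
    Nat.cast_pos.1 (show (0 : ℝ) < d by linarith)
  refine ⟨fun r hr0 hr x t ht => ?_, fun r hr0 hr β hβ x t ht => ?_⟩
  · have hd := hd_of r hr0 hr
    have : Nonempty (Fin d) := ⟨⟨0, hd⟩⟩
    rcases hr0.eq_or_lt with rfl | hr0
    · simp only [neg_zero, ENNReal.rpow_zero, mul_one, stableKernel]
      rw [lintegral_sub_right_eq_self (fun y => ENNReal.ofReal (stableDensity d α t y))]
      exact lintegral_stableDensity_le_one hd hα0 hα2 ht
    rcases eq_or_ne x 0 with rfl | hx
    · rw [hzero r hr0]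
      exact le_top
    set β := ((d : ℝ) - α - r) / α with hβ
    have hβ0 : 0 ≤ β := div_nonneg (by linarith) hα0.le
    have hβr : (d : ℝ) - α * (β + 1) = r := by
      rw [hβ]
      field_simp
      ring
    have hK := potentialConstant_pos (d := d) hα0 (by linarith : -1 < β) (by linarith)
    have hpot : ∀ y : EuclideanSpace ℝ (Fin d), y ≠ 0 → weightedPotential d α β y
        = ENNReal.ofReal (potentialConstant d α β) * ‖y‖ₑ ^ (-r) := fun y hy => by
      rw [weightedPotential_eq hd hα0 hα2 (by linarith) (by linarith) hy, hβr]
    have h := lintegral_stableKernel_mul_weightedPotential_le hd hα0 hα2 hβ0 ht x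
    rw [hpot x hx] at h
    refine (ENNReal.mul_le_mul_iff_right (ENNReal.ofReal_pos.2 hK).ne'
      ENNReal.ofReal_ne_top).1 (le_trans (le_of_eq ?_) h)
    rw [← lintegral_const_mul' _ _ ENNReal.ofReal_ne_top]
    refine lintegral_congr_ae ((Measure.ae_ne volume 0).mono fun y hy => ?_)
    simp only
    rw [hpot y hy, mul_left_comm]
  · have hd := hd_of r hr0.le hr.le
    have : Nonempty (Fin d) := ⟨⟨0, hd⟩⟩
    have hβ0 : 0 < β := hβ ▸ div_pos (by linarith) hα0
    have hβr : (d : ℝ) - α * (β + 1) = r := by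
      rw [hβ]
      field_simp
      ring
    have hK := potentialConstant_pos (d := d) hα0 (by linarith : -1 < β) (by linarith)
    have hpot : ∀ y : EuclideanSpace ℝ (Fin d), y ≠ 0 → weightedPotential d α β y
        = ENNReal.ofReal (potentialConstant d α β) * ‖y‖ₑ ^ (-r) := fun y hy => by
      rw [weightedPotential_eq hd hα0 hα2 (by linarith) (by linarith) hy, hβr]
    -- off the origin, `q h_β = β h_{β-1}`
    have hq : ∀ z : EuclideanSpace ℝ (Fin d), z ≠ 0 →
        ENNReal.ofReal (potentialConstant d α β) * (hardyPotential d α β z * ‖z‖ₑ ^ (-r))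
          = ENNReal.ofReal β * weightedPotential d α (β - 1) z := fun z hz => by
      have hαβ : α * (β - 1 + 1) < d := by
        rw [sub_add_cancel]
        linarith
      have hH : 0 ≤ hardyCoefficient d α β := by
        have h1 := mul_potentialConstant_sub_one hα0 hβ0 (show α * (β + 1) < d by linarith)
        have h2 := potentialConstant_pos (d := d) hα0 (by linarith : -1 < β - 1) hαβ
        refine nonneg_of_mul_nonneg_left ?_ hK
        rw [← h1]
        positivity
      rw [weightedPotential_eq hd hα0 hα2 (by linarith) hαβ hz, hardyPotential, ← mul_assoc,
        ← mul_assoc, ← mul_assoc, ← ENNReal.ofReal_mul hK.le, ← ENNReal.ofReal_mul hβ0.le,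
        mul_potentialConstant_sub_one hα0 hβ0 (by linarith), mul_comm (potentialConstant d α β),
        mul_assoc, ← ENNReal.rpow_add _ _ (enorm_ne_zero.2 hz) enorm_ne_top]
      congr 2
      linarith
    refine lintegral_schrodingerPerturbation_mul_le (h := fun y => ‖y‖ₑ ^ (-r))
      (measurable_stableKernel_uncurry d α) ?_ (by fun_prop) (fun t ht x => ?_) ht x
    · unfold hardyPotential
      fun_prop
    rcases eq_or_ne x 0 with rfl | hx
    · simp only [hzero r hr0]
      exact le_top
    have h := lintegral_weightedPotential_add_lintegral hd hα0 hα2 hβ0 ht x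
    rw [hpot x hx] at h
    refine (ENNReal.mul_le_mul_iff_right (ENNReal.ofReal_pos.2 hK).ne'
      ENNReal.ofReal_ne_top).1 (le_trans (le_of_eq ?_) h.le)
    rw [mul_add, ← lintegral_const_mul' _ _ ENNReal.ofReal_ne_top,
      ← lintegral_const_mul' _ _ ENNReal.ofReal_ne_top]
    congr 1
    · refine lintegral_congr_ae ((Measure.ae_ne volume 0).mono fun y hy => ?_)
      simp only
      rw [hpot y hy, mul_left_comm]
    · refine lintegral_congr fun s => ?_
      rw [← lintegral_const_mul' _ _ ENNReal.ofReal_ne_top,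
        ← lintegral_const_mul' _ _ ENNReal.ofReal_ne_top]
      refine lintegral_congr_ae ((Measure.ae_ne volume 0).mono fun z hz => ?_)
      simp only
      rw [mul_left_comm, hq z hz, mul_left_comm]
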